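/- **Setting.** Let $\mathbb R^{3\times3}_{\rm sym}$ be the space of symmetric $3\times 3$ tensors with the scalar product $a:b=\sum_{i,j}a_{ij}b_{ij}$ and norm $|a|^2=a:a$, and $\mathbb R^{3\times3}_{\rm dev}$ its subspace of trace-free tensors. * $\Omega\subset\mathbb R^3$ is a non-empty, bounded, connected open set with Lipschitz boundary, and $\Gamma_{\rm Dir}\subset\partial\Omega$ is relatively open in $\partial\Omega$ and such that, for some $c_0>0$, the Korn inequality $c_0\|u\|^2_{H^1(\Omega;\mathbb R^3)}\le\|u\|^2_{L^2(\Gamma_{\rm Dir};\mathbb R^3)}+\|\varepsilon(u)\|^2_{L^2(\Omega)}$ holds for all $u\in H^1(\Omega;\mathbb R^3)$, where $\varepsilon(u)=(\nabla u+\nabla u^{\top})/2$. * $\mathbb C:\mathbb R^{3\times3}_{\rm sym}\to\mathbb R^{3\times3}_{\rm sym}$ is linear, symmetric and positive definite, and $\mathcal C(a)=\frac12\int_\Omega\mathbb C a:a\,dx$. * $c_1,c_2,c_3>0$ and $F_0(a)=c_1|a|+c_2|a|^2+I(a)$ on $\mathbb R^{3\times3}_{\rm dev}$, where $I(a)=0$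 if $|a|\le c_3$ and $I(a)=+\infty$ otherwise. For $\rho>0$, $F_\rho\in C^{2,1}(\mathbb R^{3\times3}_{\rm dev})$ is a given real function with $F_\rho(0)=0$ whose Hessian is bounded and Lipschitz continuous and satisfies $\nabla^2F_\rho(a)[b,b]\ge c_2|b|^2$ for all $a,b$. For $\rho\ge0$, $\mathcal F_\rho(z)=\int_\Omega F_\rho(z)\,dx$ if $F_\rho(z)\in L^1(\Omega)$, and $\mathcal F_\rho(z)=+\infty$ otherwise. * For $\nu\ge0$ let $\mathcal Y^\nu=H^1(\Omega;\mathbb R^3)\times H^{j(\nu)}(\Omega;\mathbb R^{3\times3}_{\rm dev})$ with $j(0)=0$ (that is, $L^2$) and $j(\nu)=1$ for $\nu>0$, and, for $\bar u\in H^1(\Omega;\mathbb R^3)$, $\mathcal Y^\nu(\bar u)=\{(u,z)\in\mathcal Y^\nu: u=\bar u\text{ on }\Gamma_{\rm Dir}\}$ in the sense of traces. For $(u,z)\in\mathcal Y^\nu$ let $$\mathcal W_{\rho,\nu}(u,z)=\mathcal C(\varepsilon(u)-z)+\mathcal F_\rho(z)+\frac\nu2\int_\Omega|\nabla z|^2dx,\qquad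 \mathcal A_\nu(u,z)=\mathcal C(\varepsilon(u)-z)+c_2\int_\Omega|z|^2dx+\frac\nu2\int_\Omega|\nabla z|^2dx$$ (the terms with $\nabla z$ are absent if $\nu=0$), and let $\alpha>0$ be a uniform ellipticity constant of $\mathcal A_\nu$: $$\alpha\big(\|\varepsilon(u)\|^2_{L^2}+\|z\|^2_{L^2}+\nu\|z\|^2_{H^1}\big)\le\mathcal A_\nu(u,z)\quad\text{for all }(u,z)\in\mathcal Y^\nu .$$ * $D:\mathbb R^{3\times3}_{\rm dev}\to[0,\infty)$ is lower semicontinuous, positively $1$-homogeneous, satisfies $D(a+b)\le D(a)+D(b)$, and $c_D|a|\le D(a)\le C_D|a|$ for all $a$, for some constants $c_D,C_D>0$; $\mathcal D(a)=\int_\Omega D(a)\,dx$ for $a\in L^1(\Omega;\mathbb R^{3\times3}_{\rm dev})$. **Lemma (Continuous dependence).** Let $\rho,\nu\ge0$ be fixed, and let $\bar z_1,\bar z_2\in L^2(\Omega;\mathbb R^{3\times3}_{\rm dev})$, $u_1^{\rm Dir},u_2^{\rm Dir}\in H^1(\Omega;\mathbb R^3)$ and $\ell_1,\ell_2\in(H^1(\Omega;\mathbb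 R^3))'$ be given. For $i=1,2$ let $(u_i,z_i)\in\mathcal Y^\nu(u_i^{\rm Dir})$ be a minimizer of $$(v,w)\mapsto\mathcal W_{\rho,\nu}(v,w)-\langle\ell_i,v\rangle+\mathcal D(w-\bar z_i)$$ over $\mathcal Y^\nu(u_i^{\rm Dir})$. Then there exists a constant $c$, depending only on $c_0$, $\alpha$, $C_D$ and $\mathbb C$, such that $$\|u_1-u_2\|^2_{H^1(\Omega)}+\|z_1-z_2\|^2_{L^2(\Omega)}+\nu\|z_1-z_2\|^2_{H^1(\Omega)}\le c\Big(\|u_1^{\rm Dir}-u_2^{\rm Dir}\|^2_{H^1(\Omega)}+\|\bar z_1-\bar z_2\|_{L^1(\Omega)}+\|\ell_1-\ell_2\|^2_{(H^1(\Omega))'}\Big)$$ (for $\nu=0$ the term $\nu\|z_1-z_2\|^2_{H^1(\Omega)}$ is $0$). -/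

import Mathlib

open MeasureTheory Filter Topology
open scoped ContDiff ENNReal NNReal

noncomputable section

namespace ShapeMemory

/-! ## Tensors -/

/-- The Euclidean space `ℝ³`. -/
abbrev E3 : Type := EuclideanSpace ℝ (Fin 3)

/-- Real `3 × 3` tensors with the Frobenius scalar product `a : b = ∑ a_ij b_ij`. -/
abbrev Tens : Type := EuclideanSpace ℝ (Fin 3 × Fin 3)

/-- The subspace of symmetric tensors. -/
def symSubspace : Submodule ℝ Tens where
  carrier := {a | ∀ i j, a (i, j) = a (j, i)}
  add_mem' := by
    intro a b ha hb i j
    simp [ha i j, hb i j]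
  zero_mem' := by
    intro i j
    simp
  smul_mem' := by
    intro t a ha i j
    simp [ha i j]

/-- The subspace of deviatoric (trace free) symmetric tensors. -/
def devSubspace : Submodule ℝ Tens where
  carrier := {a | a ∈ symSubspace ∧ ∑ i, a (i, i) = 0}
  add_mem' := by
    rintro a b ⟨ha, ha'⟩ ⟨hb, hb'⟩
    exact ⟨symSubspace.add_mem ha hb, by simp [Finset.sum_add_distrib, ha', hb']⟩
  zero_mem' := ⟨symSubspace.zero_mem, by simp⟩
  smul_mem' := by
    rintro t a ⟨ha, ha'⟩
    exact ⟨symSubspace.smul_mem t ha, by simp [← Finset.mul_sum, ha']⟩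

/-- The Euclidean space of symmetric `3 × 3` tensors, with the scalar product of `Tens`. -/
def Sym : Type := symSubspace

instance : NormedAddCommGroup Sym := inferInstanceAs (NormedAddCommGroup symSubspace)
instance : InnerProductSpace ℝ Sym := inferInstanceAs (InnerProductSpace ℝ symSubspace)
instance : FiniteDimensional ℝ Sym := inferInstanceAs (FiniteDimensional ℝ symSubspace)

/-- The Euclidean space of deviatoric `3 × 3` tensors, with the scalar product of `Tens`. -/
def Dev : Type := devSubspace

instance : NormedAddCommGroup Dev := inferInstanceAs (NormedAddCommGroup devSubspace)
instance : InnerProductSpace ℝ Dev := inferInstanceAs (InnerProductSpace ℝ devSubspace)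
instance : FiniteDimensional ℝ Dev := inferInstanceAs (FiniteDimensional ℝ devSubspace)

/-- The inclusion of the deviatoric tensors into the symmetric ones. -/
def devToSym : Dev →ₗ[ℝ] Sym :=
  (Submodule.inclusion fun _ ha => ha.1 : devSubspace →ₗ[ℝ] symSubspace)

section Grad

variable (V : Type) [NormedAddCommGroup V] [InnerProductSpace ℝ V]

/-- Gradients of `V`-valued functions on `ℝ³`: triples `G` of vectors, whose entry `k` stands for the
partial derivative in the direction `e_k`, with the Euclidean norm `|G|² = ∑ k, |G_k|²`. -/
def Grad : Type := PiLp 2 (fun _ : Fin 3 => V)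

instance : NormedAddCommGroup (Grad V) :=
  inferInstanceAs (NormedAddCommGroup (PiLp 2 (fun _ : Fin 3 => V)))
instance : InnerProductSpace ℝ (Grad V) :=
  inferInstanceAs (InnerProductSpace ℝ (PiLp 2 (fun _ : Fin 3 => V)))
instance [FiniteDimensional ℝ V] : FiniteDimensional ℝ (Grad V) :=
  inferInstanceAs (FiniteDimensional ℝ (PiLp 2 (fun _ : Fin 3 => V)))

variable {V}

/-- The gradient with the given partial derivatives. -/
def Grad.mk (f : Fin 3 → V) : Grad V := (WithLp.toLp 2 f : PiLp 2 (fun _ : Fin 3 => V))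

/-- The entry `k` of a gradient. -/
def Grad.entry (k : Fin 3) : Grad V →L[ℝ] V := PiLp.proj 2 (𝕜 := ℝ) (fun _ : Fin 3 => V) k

@[simp] theorem Grad.entry_mk (f : Fin 3 → V) (k : Fin 3) : Grad.entry k (Grad.mk f) = f k := rfl

theorem Grad.norm_sq (G : Grad V) : ‖G‖ ^ 2 = ∑ k, ‖Grad.entry k G‖ ^ 2 :=
  PiLp.norm_sq_eq_of_L2 (fun _ : Fin 3 => V) G

end Grad

/-- The symmetric part of a gradient: `(symGrad G)_ij = (∂_j u_i + ∂_i u_j) / 2` if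
`G_k = ∂_k u`. -/
def symGrad : Grad E3 →ₗ[ℝ] Sym :=
  LinearMap.codRestrict symSubspace
    { toFun := fun G =>
        (WithLp.toLp 2 fun p => (Grad.entry p.2 G p.1 + Grad.entry p.1 G p.2) / 2 : Tens)
      map_add' := by
        intro G H
        ext p
        simp
        ring
      map_smul' := by
        intro t G
        ext p
        simp
        ring }
    (by
      intro G i j
      simp [add_comm])

/-! ## Sobolev spaces on an open set -/

section Sobolev

variable (Ω : Set E3) (V : Type) [NormedAddCommGroup V] [InnerProductSpace ℝ V]

/-- `L²(Ω; V)`. -/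
abbrev L2 : Type := Lp V 2 (volume.restrict Ω)

variable {V} in
/-- `G` is the weak (distributional) gradient of `u` in `Ω`. -/
def IsWeakGrad (u : L2 Ω V) (G : L2 Ω (Grad V)) : Prop :=
  ∀ φ : E3 → ℝ, ContDiff ℝ ∞ φ → HasCompactSupport φ → tsupport φ ⊆ Ω → ∀ k : Fin 3,
    ∫ x in Ω, fderiv ℝ φ x (EuclideanSpace.single k 1) • u x = -∫ x in Ω, φ x • Grad.entry k (G x)

variable {Ω V} in
/-- A compactly supported continuous function times an `L²` function is integrable. -/
theorem integrable_smul_L2 {ψ : E3 → ℝ} (hψ : Continuous ψ) (hc : HasCompactSupport ψ)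
    (u : L2 Ω V) : Integrable (fun x => ψ x • u x) (volume.restrict Ω) := by
  have h1 : MemLp ψ 2 (volume.restrict Ω) := (hψ.memLp_of_hasCompactSupport hc).restrict Ω
  exact memLp_one_iff_integrable.1 ((Lp.memLp u).smul h1)

variable {Ω V} in
/-- The same for one component of an `L²` gradient. -/
theorem integrable_smul_grad {ψ : E3 → ℝ} (hψ : Continuous ψ) (hc : HasCompactSupport ψ)
    (G : L2 Ω (Grad V)) (k : Fin 3) :
    Integrable (fun x => ψ x • Grad.entry k (G x)) (volume.restrict Ω) := by
  have h := (Grad.entry (V := V) k).integrable_comp (integrable_smul_L2 hψ hc G)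
  simpa using h

variable {V} in
/-- The derivatives of a test function are continuous and compactly supported. -/
theorem testDeriv {φ : E3 → ℝ} (h1 : ContDiff ℝ ∞ φ) (h2 : HasCompactSupport φ) (e : E3) :
    Continuous (fun x => fderiv ℝ φ x e) ∧ HasCompactSupport (fun x => fderiv ℝ φ x e) :=
  ⟨(h1.continuous_fderiv (by simp)).clm_apply continuous_const, h2.fderiv_apply (𝕜 := ℝ) e⟩

/-- `H¹(Ω; V)`, realized as the space of all pairs `(u, ∇u)` in `L²(Ω; V) × L²(Ω; V³)` in which
`∇u` is the weak gradient of `u`. The inherited norm is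
`‖u‖²_{H¹} = ‖u‖²_{L²} + ‖∇u‖²_{L²}`. -/
def H1 : Submodule ℝ (WithLp 2 (L2 Ω V × L2 Ω (Grad V))) where
  carrier := {p | IsWeakGrad Ω p.fst p.snd}
  add_mem' := by
    intro p q hp hq φ h1 h2 h3 k
    have e1 := hp φ h1 h2 h3 k
    have e2 := hq φ h1 h2 h3 k
    obtain ⟨hd, hdc⟩ := testDeriv h1 h2 (EuclideanSpace.single k 1)
    have a1 : ∫ x in Ω, fderiv ℝ φ x (EuclideanSpace.single k 1) • (p + q).fst x =
        ∫ x in Ω, (fderiv ℝ φ x (EuclideanSpace.single k 1) • p.fst x +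
          fderiv ℝ φ x (EuclideanSpace.single k 1) • q.fst x) := by
      refine integral_congr_ae ?_
      filter_upwards [Lp.coeFn_add p.fst q.fst] with x hx
      rw [WithLp.add_fst, hx, Pi.add_apply, smul_add]
    have a2 : ∫ x in Ω, φ x • Grad.entry k ((p + q).snd x) =
        ∫ x in Ω, (φ x • Grad.entry k (p.snd x) + φ x • Grad.entry k (q.snd x)) := by
      refine integral_congr_ae ?_
      filter_upwards [Lp.coeFn_add p.snd q.snd] with x hx
      rw [WithLp.add_snd, hx, Pi.add_apply, map_add, smul_add]
    rw [a1, a2, integral_add (integrable_smul_L2 hd hdc _) (integrable_smul_L2 hd hdc _),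
      integral_add (integrable_smul_grad h1.continuous h2 _ k)
        (integrable_smul_grad h1.continuous h2 _ k), e1, e2]
    abel
  zero_mem' := by
    intro φ h1 h2 h3 k
    have a1 : ∫ x in Ω, fderiv ℝ φ x (EuclideanSpace.single k 1) •
        (0 : WithLp 2 (L2 Ω V × L2 Ω (Grad V))).fst x = 0 := by
      refine integral_eq_zero_of_ae ?_
      filter_upwards [Lp.coeFn_zero V 2 (volume.restrict Ω)] with x hx
      rw [WithLp.zero_fst, hx]
      simp
    have a2 : ∫ x in Ω, φ x • Grad.entry k ((0 : WithLp 2 (L2 Ω V × L2 Ω (Grad V))).snd x) = 0 := by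
      refine integral_eq_zero_of_ae ?_
      filter_upwards [Lp.coeFn_zero (Grad V) 2 (volume.restrict Ω)] with x hx
      rw [WithLp.zero_snd, hx]
      simp
    rw [a1, a2, neg_zero]
  smul_mem' := by
    intro t p hp φ h1 h2 h3 k
    have e1 := hp φ h1 h2 h3 k
    have a1 : ∫ x in Ω, fderiv ℝ φ x (EuclideanSpace.single k 1) • (t • p).fst x =
        ∫ x in Ω, t • (fderiv ℝ φ x (EuclideanSpace.single k 1) • p.fst x) := by
      refine integral_congr_ae ?_
      filter_upwards [Lp.coeFn_smul t p.fst] with x hx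
      rw [WithLp.smul_fst, hx, Pi.smul_apply, smul_comm]
    have a2 : ∫ x in Ω, φ x • Grad.entry k ((t • p).snd x) =
        ∫ x in Ω, t • (φ x • Grad.entry k (p.snd x)) := by
      refine integral_congr_ae ?_
      filter_upwards [Lp.coeFn_smul t p.snd] with x hx
      rw [WithLp.smul_snd, hx, Pi.smul_apply, map_smul, smul_comm]
    rw [a1, a2, integral_smul, integral_smul, e1, smul_neg]

open Classical in
/-- `H^{j(ν)}(Ω; V)` with `j(0) = 0` and `j(ν) = 1` for `ν ≠ 0`. For `ν = 0` this is `L²(Ω; V)`,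
realized as the space of all pairs `(z, 0)`; for `ν ≠ 0` it is `H¹(Ω; V)`, the pairs `(z, ∇z)`. -/
def HSpace (ν : ℝ) : Submodule ℝ (WithLp 2 (L2 Ω V × L2 Ω (Grad V))) :=
  if ν = 0 then (WithLp.sndₗ 2 ℝ (L2 Ω V) (L2 Ω (Grad V))).ker else H1 Ω V

end Sobolev

/-- The displacements `𝒰 = H¹(Ω; ℝ³)`. -/
abbrev USpace (Ω : Set E3) : Type := H1 Ω E3

/-- The internal variables `𝒵^ν = H^{j(ν)}(Ω; ℝ³ˣ³_dev)`. -/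
abbrev ZSpace (Ω : Set E3) (ν : ℝ) : Type := HSpace Ω Dev ν

/-- The linearized strain `ε(u) = (∇u + ∇uᵀ) / 2`. -/
def strain {Ω : Set E3} (u : USpace Ω) (x : E3) : Sym := symGrad (u.1.snd x)

/-! ## Reference configuration -/

/-- Bounded, non-empty, connected open sets with Lipschitz boundary: near each boundary point, in
suitable orthonormal coordinates, `Ω` is the strict epigraph of a Lipschitz function. -/
structure IsLipschitzDomain (Ω : Set E3) : Prop where
  isOpen : IsOpen Ω
  isConnected : IsConnected Ω
  isBounded : Bornology.IsBounded Ω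
  lipschitz_boundary : ∀ x₀ ∈ frontier Ω, ∃ r > 0, ∃ R : E3 ≃ₗᵢ[ℝ] E3,
    ∃ γ : EuclideanSpace ℝ (Fin 2) → ℝ, (∃ L : ℝ≥0, LipschitzWith L γ) ∧
      ∀ x ∈ Metric.ball x₀ r, (x ∈ Ω ↔ γ (!₂[R x 0, R x 1]) < R x 2)

/-- The surface measure on `∂Ω`: the two-dimensional Hausdorff measure (with the normalization that
agrees with the area on planes). -/
def surfaceMeasure (Ω : Set E3) : Measure E3 := (μHE[2] : Measure E3).restrict (frontier Ω)

/-- The gradient of a differentiable function, in the format of `Grad`. -/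
def classicalGrad (φ : E3 → E3) (x : E3) : Grad E3 :=
  Grad.mk fun k => fderiv ℝ φ x (EuclideanSpace.single k 1)

/-- `g ∈ L²(∂Ω; ℝ³)` is the trace of `u ∈ H¹(Ω; ℝ³)` on `∂Ω`: functions that are smooth up to the
boundary converge to `u` in `H¹(Ω; ℝ³)` and their restrictions to `∂Ω` converge to `g` in
`L²(∂Ω; ℝ³)`. -/
def HasTrace {Ω : Set E3} (u : USpace Ω) (g : Lp E3 2 (surfaceMeasure Ω)) : Prop :=
  ∃ φ : ℕ → E3 → E3, (∀ n, ContDiff ℝ ∞ (φ n)) ∧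
    Tendsto (fun n => eLpNorm (fun x => φ n x - u.1.fst x) 2 (volume.restrict Ω)) atTop (𝓝 0) ∧
    Tendsto (fun n => eLpNorm (fun x => classicalGrad (φ n) x - u.1.snd x) 2 (volume.restrict Ω))
      atTop (𝓝 0) ∧
    Tendsto (fun n => eLpNorm (fun x => φ n x - g x) 2 (surfaceMeasure Ω)) atTop (𝓝 0)

/-- `u = ū` on `Γ` in the sense of traces: the trace of `u - ū` vanishes almost everywhere
on `Γ`. -/
def EqOnBoundary {Ω : Set E3} (Γ : Set E3) (u ubar : USpace Ω) : Prop :=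
  ∃ g : Lp E3 2 (surfaceMeasure Ω), HasTrace (u - ubar) g ∧
    ∀ᵐ x ∂((surfaceMeasure Ω).restrict Γ), g x = 0

/-- The Korn inequality on `Ω` with constant `c₀` and boundary part `Γ`:
`c₀ ‖u‖²_{H¹(Ω)} ≤ ‖u‖²_{L²(Γ)} + ‖ε(u)‖²_{L²(Ω)}` for all `u ∈ H¹(Ω; ℝ³)`. -/
def KornInequality (Ω Γ : Set E3) (c₀ : ℝ) : Prop :=
  ∀ (u : USpace Ω) (g : Lp E3 2 (surfaceMeasure Ω)), HasTrace u g →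
    c₀ * ‖u‖ ^ 2 ≤ (∫ x in Γ, ‖g x‖ ^ 2 ∂(surfaceMeasure Ω)) + ∫ x in Ω, ‖strain u x‖ ^ 2

/-! ## Energies -/

/-- Elasticity tensors: symmetric positive definite linear maps on the symmetric tensors. -/
def IsElasticityTensor (C : Sym →ₗ[ℝ] Sym) : Prop :=
  C.IsSymmetric ∧ ∀ a : Sym, a ≠ 0 → 0 < inner ℝ (C a) a

/-- The stored elastic energy `𝒞(a) = ½ ∫_Ω ℂ a : a`. -/
def elasticEnergy (Ω : Set E3) (C : Sym →ₗ[ℝ] Sym) (a : E3 → Sym) : ℝ :=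
  1 / 2 * ∫ x in Ω, inner ℝ (C (a x)) (a x)

open Classical in
/-- The inelastic energy density `F(a) = c₁ |a| + c₂ |a|² + I(a)`, where `I` is the indicator
function (`0` or `+∞`) of the ball `|a| ≤ c₃`. -/
def inelasticDensity (c₁ c₂ c₃ : ℝ) (a : Dev) : EReal :=
  if ‖a‖ ≤ c₃ then ((c₁ * ‖a‖ + c₂ * ‖a‖ ^ 2 : ℝ) : EReal) else ⊤

/-- The conditions on a regularized density: it is of class `C^{2,1}`, its second derivative is
bounded and at least `c₂`, and it vanishes at `0`. -/
structure IsRegularizedDensity (c₂ : ℝ) (Φ : Dev → ℝ) : Prop where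
  contDiff : ContDiff ℝ 2 Φ
  lipschitz_hessian : ∃ L : ℝ≥0, LipschitzWith L (fderiv ℝ (fderiv ℝ Φ))
  bounded_hessian : ∃ M : ℝ, ∀ a, ‖fderiv ℝ (fderiv ℝ Φ) a‖ ≤ M
  hessian_ge : ∀ a b : Dev, c₂ * ‖b‖ ^ 2 ≤ fderiv ℝ (fderiv ℝ Φ) a b b
  map_zero : Φ 0 = 0

open Classical in
/-- The densities `F_ρ`, `ρ ≥ 0`: the original one for `ρ = 0` and the given regularizations
`Freg ρ` for `ρ > 0`. -/
def density (c₁ c₂ c₃ : ℝ) (Freg : ℝ → Dev → ℝ) (ρ : ℝ) (a : Dev) : EReal :=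
  if ρ = 0 then inelasticDensity c₁ c₂ c₃ a else (Freg ρ a : EReal)

open Classical in
/-- The integral functional `z ↦ ∫_Ω Φ(z)` for a density `Φ` with values in `(-∞, +∞]`; it is
`+∞` if `Φ(z)` is not in `L¹(Ω)`. -/
def integralFunctional (Ω : Set E3) (Φ : Dev → EReal) (z : E3 → Dev) : EReal :=
  if (∀ᵐ x ∂(volume.restrict Ω), Φ (z x) ≠ ⊤) ∧
      Integrable (fun x => (Φ (z x)).toReal) (volume.restrict Ω) then
    ((∫ x in Ω, (Φ (z x)).toReal : ℝ) : EReal)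
  else ⊤

/-- The inelastic energy `ℱ_{ρ,ν}(z) = ∫_Ω F_ρ(z) + (ν / 2) ∫_Ω |∇z|²` for the density
`Φ = F_ρ`. -/
def inelasticEnergy {Ω : Set E3} {ν : ℝ} (Φ : Dev → EReal) (z : ZSpace Ω ν) : EReal :=
  integralFunctional Ω Φ (fun x => z.1.fst x) + ((ν / 2 * ∫ x in Ω, ‖z.1.snd x‖ ^ 2 : ℝ) : EReal)

/-- The stored energy `𝒲_{ρ,ν}(u, z) = 𝒞(ε(u) - z) + ℱ_{ρ,ν}(z)`, with `Φ = F_ρ`. -/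
def storedEnergy {Ω : Set E3} {ν : ℝ} (C : Sym →ₗ[ℝ] Sym) (Φ : Dev → EReal)
    (u : USpace Ω) (z : ZSpace Ω ν) : EReal :=
  (elasticEnergy Ω C (fun x => strain u x - devToSym (z.1.fst x)) : EReal) + inelasticEnergy Φ z

/-- The quadratic form `𝒜_ν(u, z) = 𝒞(ε(u) - z) + c₂ ∫_Ω |z|² + (ν / 2) ∫_Ω |∇z|²`. -/
def quadForm {Ω : Set E3} {ν : ℝ} (C : Sym →ₗ[ℝ] Sym) (c₂ : ℝ)
    (u : USpace Ω) (z : ZSpace Ω ν) : ℝ :=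
  elasticEnergy Ω C (fun x => strain u x - devToSym (z.1.fst x))
    + c₂ * (∫ x in Ω, ‖z.1.fst x‖ ^ 2) + ν / 2 * ∫ x in Ω, ‖z.1.snd x‖ ^ 2

/-- `α > 0` is a uniform ellipticity constant of `𝒜_ν`:
`α (‖ε(u)‖²_{L²} + ‖z‖²_{L²} + ν ‖z‖²_{H¹}) ≤ 𝒜_ν(u, z)` on `𝒴^ν`. -/
def IsEllipticityConstant (Ω : Set E3) (C : Sym →ₗ[ℝ] Sym) (c₂ ν α : ℝ) : Prop :=
  0 < α ∧ ∀ (u : USpace Ω) (z : ZSpace Ω ν),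
    α * ((∫ x in Ω, ‖strain u x‖ ^ 2) + ‖z.1.fst‖ ^ 2 + ν * ‖z‖ ^ 2) ≤ quadForm C c₂ u z

/-- Elasticity tensors are uniformly positive definite. -/
theorem exists_coercive {C : Sym →ₗ[ℝ] Sym} (hC : IsElasticityTensor C) :
    ∃ m > 0, ∀ a : Sym, m * ‖a‖ ^ 2 ≤ inner ℝ (C a) a := by
  have hc : Continuous fun a : Sym => inner ℝ (C a) a :=
    (C.continuous_of_finiteDimensional).inner continuous_id
  rcases (Metric.sphere (0 : Sym) 1).eq_empty_or_nonempty with h | h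
  · refine ⟨1, one_pos, fun a => ?_⟩
    by_cases ha : a = 0
    · simp [ha]
    · exfalso
      have : (‖a‖⁻¹ • a) ∈ Metric.sphere (0 : Sym) 1 := by
        simp [norm_smul, ha]
      simp [h] at this
  · obtain ⟨b, hb, hmin⟩ := (isCompact_sphere (0 : Sym) 1).exists_isMinOn h hc.continuousOn
    have hb0 : b ≠ 0 := by
      rintro rfl
      simp at hb
    refine ⟨_, hC.2 b hb0, fun a => ?_⟩
    by_cases ha : a = 0
    · simp [ha]
    · have h1 : (‖a‖⁻¹ • a) ∈ Metric.sphere (0 : Sym) 1 := by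
        simp [norm_smul, ha]
      have h2 := hmin h1
      simp only [Set.mem_ofPred_eq, map_smul, inner_smul_left, inner_smul_right] at h2
      have h3 : 0 < ‖a‖ := norm_pos_iff.2 ha
      have h4 : inner ℝ (C a) a = ‖a‖ ^ 2 * (‖a‖⁻¹ * (‖a‖⁻¹ * inner ℝ (C a) a)) := by
        field_simp
      rw [h4, mul_comm]
      have h5 : inner ℝ (C b) b ≤ ‖a‖⁻¹ * (‖a‖⁻¹ * inner ℝ (C a) a) := by simpa using h2
      gcongr

/-- The norm of `L²` as an integral. -/
theorem L2_norm_sq {Ω : Set E3} {V : Type} [NormedAddCommGroup V] [InnerProductSpace ℝ V]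
    (u : L2 Ω V) : ‖u‖ ^ 2 = ∫ x in Ω, ‖u x‖ ^ 2 := by
  rw [← real_inner_self_eq_norm_sq, L2.inner_def]
  simp

/-- The quadratic form `𝒜_ν` has a uniform ellipticity constant. -/
theorem exists_ellipticityConstant (Ω : Set E3) {C : Sym →ₗ[ℝ] Sym} (hC : IsElasticityTensor C)
    {c₂ ν : ℝ} (hc₂ : 0 < c₂) (hν : 0 ≤ ν) : ∃ α, IsEllipticityConstant Ω C c₂ ν α := by
  obtain ⟨m, hm, hmC⟩ := exists_coercive hC
  refine ⟨min (m / 4) (min (c₂ / (3 + ν)) (1 / 2)), by positivity, fun u z => ?_⟩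
  set α := min (m / 4) (min (c₂ / (3 + ν)) (1 / 2)) with hα
  have a0 : 0 < α := by positivity
  have a1 : α ≤ m / 4 := min_le_left _ _
  have a2 : α * (3 + ν) ≤ c₂ := by
    rw [← le_div_iff₀ (by positivity)]
    exact (min_le_right _ _).trans (min_le_left _ _)
  have a3 : α ≤ 1 / 2 := (min_le_right _ _).trans (min_le_right _ _)
  have ms : MemLp (strain u) 2 (volume.restrict Ω) :=
    (LinearMap.toContinuousLinearMap symGrad).comp_memLp' (Lp.memLp u.1.snd)
  have mz : MemLp (fun x => devToSym (z.1.fst x)) 2 (volume.restrict Ω) :=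
    (LinearMap.toContinuousLinearMap devToSym).comp_memLp' (Lp.memLp z.1.fst)
  have md := ms.sub mz
  have is := ms.integrable_norm_pow (by norm_num)
  have iz := mz.integrable_norm_pow (by norm_num)
  have id := md.integrable_norm_pow (by norm_num)
  have mC : MemLp (fun x => C (strain u x - devToSym (z.1.fst x))) 2 (volume.restrict Ω) :=
    (LinearMap.toContinuousLinearMap C).comp_memLp' md
  have iC : Integrable (fun x => inner ℝ (C (strain u x - devToSym (z.1.fst x)))
      (strain u x - devToSym (z.1.fst x))) (volume.restrict Ω) := by
    have h := L2.integrable_inner (𝕜 := ℝ) (mC.toLp _) (md.toLp _)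
    refine h.congr ?_
    filter_upwards [mC.coeFn_toLp, md.coeFn_toLp] with x h1 h2
    rw [h1, h2]
    rfl
  simp only [Pi.sub_apply] at id
  have e1 : m * ∫ x in Ω, ‖strain u x - devToSym (z.1.fst x)‖ ^ 2 ≤
      ∫ x in Ω, inner ℝ (C (strain u x - devToSym (z.1.fst x)))
        (strain u x - devToSym (z.1.fst x)) := by
    rw [← integral_const_mul]
    exact integral_mono (id.const_mul m) iC fun x => hmC _
  have hz : ∀ a : Dev, ‖devToSym a‖ = ‖a‖ := fun a => rfl
  have e2 : ∫ x in Ω, ‖strain u x‖ ^ 2 ≤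
      2 * (∫ x in Ω, ‖strain u x - devToSym (z.1.fst x)‖ ^ 2) + 2 * ∫ x in Ω, ‖z.1.fst x‖ ^ 2 := by
    rw [← integral_const_mul, ← integral_const_mul]
    simp only [hz] at iz
    rw [← integral_add (id.const_mul 2) (iz.const_mul 2)]
    refine integral_mono is ((id.const_mul 2).add (iz.const_mul 2)) fun x => ?_
    have h := norm_add_le (strain u x - devToSym (z.1.fst x)) (devToSym (z.1.fst x))
    rw [sub_add_cancel, hz] at h
    have h0 := norm_nonneg (strain u x)
    nlinarith [sq_nonneg (‖strain u x - devToSym (z.1.fst x)‖ - ‖z.1.fst x‖)]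
  have e3 : ‖z‖ ^ 2 = (∫ x in Ω, ‖z.1.fst x‖ ^ 2) + ∫ x in Ω, ‖z.1.snd x‖ ^ 2 := by
    rw [Submodule.coe_norm, WithLp.prod_norm_sq_eq_of_L2, L2_norm_sq, L2_norm_sq]
  rw [e3, L2_norm_sq, quadForm, elasticEnergy]
  have p1 : 0 ≤ ∫ x in Ω, ‖strain u x - devToSym (z.1.fst x)‖ ^ 2 :=
    integral_nonneg fun x => by positivity
  have p2 : 0 ≤ ∫ x in Ω, ‖z.1.fst x‖ ^ 2 := integral_nonneg fun x => by positivity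
  have p3 : 0 ≤ ν * ∫ x in Ω, ‖z.1.snd x‖ ^ 2 :=
    mul_nonneg hν (integral_nonneg fun x => by positivity)
  nlinarith [mul_le_mul_of_nonneg_left e2 a0.le, mul_le_mul_of_nonneg_right a1 p1,
    mul_le_mul_of_nonneg_right a2 p2, mul_le_mul_of_nonneg_right a3 p3]

/-- Dissipation potentials: lower semicontinuous, positively `1`-homogeneous, subadditive and
non-degenerate functions `D : ℝ³ˣ³_dev → [0, ∞)`. -/
structure IsDissipationPotential (D : Dev → ℝ) : Prop where
  nonneg : ∀ a, 0 ≤ D a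
  lowerSemicontinuous : LowerSemicontinuous D
  homogeneous : ∀ t : ℝ, 0 < t → ∀ a, D (t • a) = t * D a
  triangle : ∀ a b, D (a + b) ≤ D a + D b
  nondegenerate : ∃ cD > 0, ∀ a : Dev, cD * ‖a‖ ≤ D a

/-- The dissipation functional `𝒟(a) = ∫_Ω D(a)`. -/
def dissipation (Ω : Set E3) (D : Dev → ℝ) (a : E3 → Dev) : ℝ := ∫ x in Ω, D (a x)

/-! ## The incremental problem -/

/-- The affine space `𝒴^ν(ū)` of all `(u, z) ∈ 𝒴^ν` with `u = ū` on `Γ`. -/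
def admissible (Ω Γ : Set E3) (ν : ℝ) (ubar : USpace Ω) : Set (USpace Ω × ZSpace Ω ν) :=
  {p | EqOnBoundary Γ p.1 ubar}

/-- The functional `𝒲_{ρ,ν}(u, z) - ⟨ℓ, u⟩ + 𝒟(z - z̄)`, with `Φ = F_ρ`. -/
def incrementalFunctional {Ω : Set E3} {ν : ℝ} (C : Sym →ₗ[ℝ] Sym) (Φ : Dev → EReal)
    (D : Dev → ℝ) (ℓ : StrongDual ℝ (USpace Ω)) (zbar : L2 Ω Dev)
    (p : USpace Ω × ZSpace Ω ν) : EReal :=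
  storedEnergy C Φ p.1 p.2 - (ℓ p.1 : EReal)
    + (dissipation Ω D (fun x => p.2.1.fst x - zbar x) : EReal)

/-- `p = (u, z)` solves the incremental problem with data `uDir`, `z̄`, `ℓ`: it minimizes the
incremental functional over `𝒴^ν(uDir)`. -/
def SolvesIncremental {Ω : Set E3} {ν : ℝ} (Γ : Set E3) (C : Sym →ₗ[ℝ] Sym)
    (Φ : Dev → EReal) (D : Dev → ℝ) (uDir : USpace Ω) (zbar : L2 Ω Dev)
    (ℓ : StrongDual ℝ (USpace Ω)) (p : USpace Ω × ZSpace Ω ν) : Prop :=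
  p ∈ admissible Ω Γ ν uDir ∧
    IsMinOn (incrementalFunctional C Φ D ℓ zbar) (admissible Ω Γ ν uDir) p

end ShapeMemory

end

/-!
The incremental functional is strongly convex: its elastic part is a nonnegative quadratic form, the
dissipation is convex, and the densities `F_ρ` are strongly convex with constant `c₂`, for `ρ = 0`
because of the term `c₂ |a|²` and for `ρ > 0` because of the lower bound on the Hessian
(`exists_isConvexDensity`). A minimizer `p` therefore satisfies not only `J p ≤ J q` but
`J p + Q (p - q) ≤ J q` for all competitors `q` of finite energy, with the quadratic form
`Q = convexityForm` (`SolvesIncremental.realFunctional_add_le`). Since `2 Q ≥ 𝒜_ν`, the form `Q` is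
elliptic.

Let `e` be the difference of the Dirichlet data. The pair `(u₂ + e, z₂)` is admissible in the first
problem and `(u₁ - e, z₁)` in the second one. When the two inequalities are added, the inelastic
energies cancel, and the elastic ones leave only the product of the strain of `e` with the elastic
strain of `(u₁ - u₂ - e, z₁ - z₂)`; there remain, besides, the product of `ℓ₁ - ℓ₂` with `u₁ - u₂ - e`, and the
dissipation of `z̄₁ - z̄₂`, which is at most linear (`SolvesIncremental.convexityForm_le`). The trace
of `u₁ - u₂ - e` vanishes on the Dirichlet boundary, so that Korn's inequality bounds its norm by
that of its strain, and Young's inequality absorbs the products (`absorption_estimate`).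
-/

/-! ### Convexity and growth of the densities -/

section Convexity

variable {E : Type*} [NormedAddCommGroup E] [InnerProductSpace ℝ E]

/-- Restricted to a line, `f` minus `m / 2` times the square of the norm has a nonnegative second
derivative. -/
theorem strongConvexOn_univ_of_hessian_ge {f : E → ℝ} {m : ℝ} (hf : ContDiff ℝ 2 f)
    (h : ∀ a b : E, m * ‖b‖ ^ 2 ≤ fderiv ℝ (fderiv ℝ f) a b b) :
    StrongConvexOn Set.univ m f := by
  refine ⟨convex_univ, fun x _ y _ a b ha hb hab => ?_⟩
  set d := y - x with hd
  have hf1 : Differentiable ℝ f := hf.differentiable (by norm_num)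
  have hf2 : Differentiable ℝ (fderiv ℝ f) :=
    (hf.fderiv_right (m := 1) (by norm_num)).differentiable (by norm_num)
  have hline : ∀ t : ℝ, HasDerivAt (fun t : ℝ => x + t • d) d t := fun t => by
    simpa using ((hasDerivAt_id t).smul_const d).const_add x
  have e1 : ∀ t : ℝ, HasDerivAt (fun t : ℝ => f (x + t • d) - m / 2 * ‖d‖ ^ 2 * t ^ 2)
      (fderiv ℝ f (x + t • d) d - m * ‖d‖ ^ 2 * t) t := fun t => by
    have p1 := (hf1 (x + t • d)).hasFDerivAt.comp_hasDerivAt t (hline t)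
    have p2 := (hasDerivAt_pow 2 t).const_mul (m / 2 * ‖d‖ ^ 2)
    refine (p1.sub p2).congr_deriv ?_
    push_cast
    ring
  have e2 : ∀ t : ℝ, HasDerivAt (fun t : ℝ => fderiv ℝ f (x + t • d) d - m * ‖d‖ ^ 2 * t)
      (fderiv ℝ (fderiv ℝ f) (x + t • d) d d - m * ‖d‖ ^ 2) t := fun t => by
    have p0 : HasDerivAt (fun t : ℝ => fderiv ℝ f (x + t • d))
        (fderiv ℝ (fderiv ℝ f) (x + t • d) d) t :=
      HasFDerivAt.comp_hasDerivAt (f := fun t : ℝ => x + t • d) t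
        (hf2 (x + t • d)).hasFDerivAt (hline t)
    have p1 : HasDerivAt (fun t : ℝ => fderiv ℝ f (x + t • d) d)
        (fderiv ℝ (fderiv ℝ f) (x + t • d) d d) t :=
      (ContinuousLinearMap.apply ℝ ℝ d).hasFDerivAt.comp_hasDerivAt t p0
    have p2 : HasDerivAt (fun t : ℝ => m * ‖d‖ ^ 2 * t) (m * ‖d‖ ^ 2) t := by
      simpa using (hasDerivAt_id t).const_mul (m * ‖d‖ ^ 2)
    exact p1.sub p2
  have e3 : deriv (fun t : ℝ => f (x + t • d) - m / 2 * ‖d‖ ^ 2 * t ^ 2) =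
      fun t => fderiv ℝ f (x + t • d) d - m * ‖d‖ ^ 2 * t := funext fun t => (e1 t).deriv
  have hconv : ConvexOn ℝ Set.univ (fun t : ℝ => f (x + t • d) - m / 2 * ‖d‖ ^ 2 * t ^ 2) := by
    refine convexOn_univ_of_deriv2_nonneg (fun t => (e1 t).differentiableAt) ?_ fun t => ?_
    · rw [e3]
      exact fun t => (e2 t).differentiableAt
    · rw [Function.iterate_succ, Function.iterate_one, Function.comp_apply, e3, (e2 t).deriv]
      linarith [h (x + t • d) d]
  have key := hconv.2 (Set.mem_univ 0) (Set.mem_univ 1) ha hb hab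
  have hpt : x + b • d = a • x + b • y := by
    obtain rfl : a = 1 - b := by linarith
    rw [hd]
    module
  have hxy : ‖x - y‖ = ‖d‖ := by rw [hd, norm_sub_rev]
  simp only [smul_eq_mul, mul_zero, mul_one, zero_add, zero_smul, add_zero, one_smul, hpt] at key
  rw [show x + d = y by rw [hd]; abel] at key
  simp only [smul_eq_mul, hxy]
  obtain rfl : a = 1 - b := by linarith
  nlinarith [key]

/-- A function with a bounded second derivative grows at most quadratically. -/
theorem exists_abs_le_of_bounded_hessian {f : E → ℝ} {M : ℝ} (hf : ContDiff ℝ 2 f)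
    (hM : ∀ a, ‖fderiv ℝ (fderiv ℝ f) a‖ ≤ M) (h0 : f 0 = 0) :
    ∃ K, ∀ a, |f a| ≤ K * (1 + ‖a‖ ^ 2) := by
  have hf1 : Differentiable ℝ f := hf.differentiable (by norm_num)
  have hf2 : Differentiable ℝ (fderiv ℝ f) :=
    (hf.fderiv_right (m := 1) (by norm_num)).differentiable (by norm_num)
  have hM0 : 0 ≤ M := (norm_nonneg (fderiv ℝ (fderiv ℝ f) 0)).trans (hM 0)
  have g1 : ∀ a, ‖fderiv ℝ f a‖ ≤ ‖fderiv ℝ f 0‖ + M * ‖a‖ := fun a => by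
    have h := (convex_univ (𝕜 := ℝ) (E := E)).norm_image_sub_le_of_norm_fderiv_le
      (fun x _ => hf2 x) (fun x _ => hM x) (Set.mem_univ 0) (Set.mem_univ a)
    rw [sub_zero] at h
    linarith [norm_le_norm_add_norm_sub' (fderiv ℝ f a) (fderiv ℝ f 0)]
  refine ⟨‖fderiv ℝ f 0‖ + M, fun a => ?_⟩
  have h := (convex_closedBall (0 : E) ‖a‖).norm_image_sub_le_of_norm_fderiv_le
    (f := f) (𝕜 := ℝ) (C := ‖fderiv ℝ f 0‖ + M * ‖a‖) (fun x _ => hf1 x)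
    (fun x hx => (g1 x).trans (by
      rw [mem_closedBall_zero_iff] at hx
      gcongr)) (Metric.mem_closedBall_self (norm_nonneg a)) (y := a) (by simp)
  rw [h0, sub_zero, sub_zero, Real.norm_eq_abs] at h
  nlinarith [sq_nonneg (‖a‖ - 1), norm_nonneg (fderiv ℝ f 0), norm_nonneg a,
    mul_nonneg (norm_nonneg (fderiv ℝ f 0)) (sq_nonneg (‖a‖ - 1)), mul_nonneg hM0 (norm_nonneg a),
    mul_nonneg (norm_nonneg (fderiv ℝ f 0)) (sq_nonneg (‖a‖))]

theorem strongConvexOn_norm_add_norm_sq {c₁ c₂ : ℝ} (h₁ : 0 ≤ c₁) (h₂ : 0 ≤ c₂) :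
    StrongConvexOn Set.univ c₂ (fun a : E => c₁ * ‖a‖ + c₂ * ‖a‖ ^ 2) := by
  rw [strongConvexOn_iff_convex]
  have hn : ConvexOn ℝ Set.univ (fun a : E => ‖a‖) := convexOn_univ_norm
  have hs : ConvexOn ℝ Set.univ (fun a : E => ‖a‖ ^ 2) := hn.pow (fun _ _ => norm_nonneg _) 2
  refine ((hn.smul h₁).add (hs.smul (by linarith : 0 ≤ c₂ / 2))).congr fun a _ => ?_
  simp only [Pi.add_apply, smul_eq_mul]
  ring

end Convexity

namespace ShapeMemory

/-- The properties of the densities `F_ρ`, common to `ρ = 0` and `ρ > 0`: the extended real density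
`Φ` is the real function `f` on the convex set `S` and `+∞` outside, and `f` is strongly convex and
continuous, of at most quadratic growth and zero at the origin. -/
structure IsConvexDensity (κ : ℝ) (Φ : Dev → EReal) (f : Dev → ℝ) (S : Set Dev) : Prop where
  eq_coe : ∀ a ∈ S, Φ a = f a
  eq_top : ∀ a ∉ S, Φ a = ⊤
  convex : Convex ℝ S
  zero_mem : 0 ∈ S
  map_zero : f 0 = 0
  strongConvex : StrongConvexOn Set.univ κ f
  continuous : Continuous f
  growth : ∃ K, ∀ a, |f a| ≤ K * (1 + ‖a‖ ^ 2)

theorem IsRegularizedDensity.isConvexDensity {κ : ℝ} {f : Dev → ℝ}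
    (h : IsRegularizedDensity κ f) : IsConvexDensity κ (fun a => (f a : EReal)) f Set.univ where
  eq_coe _ _ := rfl
  eq_top a ha := absurd (Set.mem_univ a) ha
  convex := convex_univ
  zero_mem := Set.mem_univ 0
  map_zero := h.map_zero
  strongConvex := strongConvexOn_univ_of_hessian_ge h.contDiff h.hessian_ge
  continuous := h.contDiff.continuous
  growth := by
    obtain ⟨M, hM⟩ := h.bounded_hessian
    exact exists_abs_le_of_bounded_hessian h.contDiff hM h.map_zero

theorem isConvexDensity_inelasticDensity {c₁ c₂ c₃ : ℝ} (h₁ : 0 < c₁) (h₂ : 0 < c₂)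
    (h₃ : 0 < c₃) :
    IsConvexDensity c₂ (inelasticDensity c₁ c₂ c₃) (fun a => c₁ * ‖a‖ + c₂ * ‖a‖ ^ 2)
      (Metric.closedBall 0 c₃) where
  eq_coe a ha := by
    rw [mem_closedBall_zero_iff] at ha
    rw [inelasticDensity, if_pos ha]
  eq_top a ha := by
    rw [mem_closedBall_zero_iff] at ha
    rw [inelasticDensity, if_neg ha]
  convex := convex_closedBall 0 c₃
  zero_mem := Metric.mem_closedBall_self h₃.le
  map_zero := by simp
  strongConvex := strongConvexOn_norm_add_norm_sq h₁.le h₂.le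
  continuous := by fun_prop
  growth := by
    refine ⟨c₁ + c₂, fun a => ?_⟩
    rw [abs_of_nonneg (by positivity)]
    nlinarith [mul_nonneg h₁.le (sq_nonneg (‖a‖ - 1)), mul_nonneg h₁.le (sq_nonneg ‖a‖)]

theorem exists_isConvexDensity {c₁ c₂ c₃ ρ : ℝ} (h₁ : 0 < c₁) (h₂ : 0 < c₂) (h₃ : 0 < c₃)
    {Freg : ℝ → Dev → ℝ} (hF : ∀ ρ > 0, IsRegularizedDensity c₂ (Freg ρ)) (hρ : 0 ≤ ρ) :
    ∃ f S, IsConvexDensity c₂ (density c₁ c₂ c₃ Freg ρ) f S := by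
  rcases hρ.eq_or_lt with rfl | hρ
  · have e : density c₁ c₂ c₃ Freg 0 = inelasticDensity c₁ c₂ c₃ := funext fun a => if_pos rfl
    exact ⟨_, _, e ▸ isConvexDensity_inelasticDensity h₁ h₂ h₃⟩
  · have e : density c₁ c₂ c₃ Freg ρ = fun a => (Freg ρ a : EReal) :=
      funext fun a => if_neg hρ.ne'
    exact ⟨_, _, e ▸ (hF ρ hρ).isConvexDensity⟩

/-! ### The inelastic and the dissipated energy -/

theorem IsConvexDensity.integrable {κ : ℝ} {Φ : Dev → EReal} {f : Dev → ℝ} {S : Set Dev}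
    (h : IsConvexDensity κ Φ f S) {Ω : Set E3} [IsFiniteMeasure (volume.restrict Ω)]
    (z : L2 Ω Dev) : Integrable (fun x => f (z x)) (volume.restrict Ω) := by
  obtain ⟨K, hK⟩ := h.growth
  have hz := (Lp.memLp z).integrable_norm_pow (by norm_num)
  refine (((integrable_const 1).add hz).const_mul K).mono'
    (h.continuous.comp_aestronglyMeasurable (Lp.aestronglyMeasurable z)) ?_
  exact .of_forall fun x => hK (z x)

/-- Because of the growth condition, the integral functional is infinite only if the values of `z`
leave the effective domain `S`. -/
theorem IsConvexDensity.integralFunctional_eq {κ : ℝ} {Φ : Dev → EReal} {f : Dev → ℝ}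
    {S : Set Dev} (h : IsConvexDensity κ Φ f S) {Ω : Set E3}
    [IsFiniteMeasure (volume.restrict Ω)] (z : L2 Ω Dev)
    (hz : ∀ᵐ x ∂(volume.restrict Ω), z x ∈ S) :
    integralFunctional Ω Φ z = ((∫ x in Ω, f (z x) : ℝ) : EReal) := by
  have e : (fun x => (Φ (z x)).toReal) =ᵐ[volume.restrict Ω] fun x => f (z x) := by
    filter_upwards [hz] with x hx
    rw [h.eq_coe _ hx, EReal.toReal_coe]
  have ht : ∀ᵐ x ∂(volume.restrict Ω), Φ (z x) ≠ ⊤ := by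
    filter_upwards [hz] with x hx
    rw [h.eq_coe _ hx]
    exact EReal.coe_ne_top _
  rw [integralFunctional, if_pos ⟨ht, (integrable_congr e).2 (h.integrable z)⟩,
    integral_congr_ae e]

theorem IsConvexDensity.ae_mem {κ : ℝ} {Φ : Dev → EReal} {f : Dev → ℝ}
    {S : Set Dev} (h : IsConvexDensity κ Φ f S) {Ω : Set E3} (z : L2 Ω Dev)
    (hz : integralFunctional Ω Φ z ≠ ⊤) : ∀ᵐ x ∂(volume.restrict Ω), z x ∈ S := by
  have h1 : ∀ᵐ x ∂(volume.restrict Ω), Φ (z x) ≠ ⊤ := by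
    by_contra hn
    exact hz (if_neg fun hc => hn hc.1)
  filter_upwards [h1] with x hx
  by_contra hxS
  exact hx (h.eq_top _ hxS)

/-- Integrated strong convexity of the density. -/
theorem IsConvexDensity.integral_le {κ : ℝ} {Φ : Dev → EReal} {f : Dev → ℝ}
    {S : Set Dev} (h : IsConvexDensity κ Φ f S) {Ω : Set E3}
    [IsFiniteMeasure (volume.restrict Ω)] (z w : L2 Ω Dev) {a b : ℝ} (ha : 0 ≤ a) (hb : 0 ≤ b)
    (hab : a + b = 1) :
    ∫ x in Ω, f ((a • z + b • w) x) ≤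
      a * (∫ x in Ω, f (z x)) + b * (∫ x in Ω, f (w x)) - a * b * (κ / 2 * ‖z - w‖ ^ 2) := by
  have hd := (Lp.memLp (z - w)).integrable_norm_pow (p := 2) (by norm_num)
  rw [L2_norm_sq, ← integral_const_mul, ← integral_const_mul, ← integral_const_mul,
    ← integral_const_mul, ← integral_add ((h.integrable z).const_mul a)
      ((h.integrable w).const_mul b), ← integral_sub]
  · refine integral_mono_ae (h.integrable _) (((h.integrable z).const_mul a).add
      ((h.integrable w).const_mul b) |>.sub ((hd.const_mul _).const_mul _)) ?_
    filter_upwards [Lp.coeFn_add (a • z) (b • w), Lp.coeFn_smul a z, Lp.coeFn_smul b w,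
      Lp.coeFn_sub z w] with x h1 h2 h3 h4
    rw [h1, Pi.add_apply, h2, h3, Pi.smul_apply, Pi.smul_apply]
    simp only [h4, Pi.sub_apply]
    exact h.strongConvex.2 (Set.mem_univ (z x)) (Set.mem_univ (w x)) ha hb hab
  · exact ((h.integrable z).const_mul a).add ((h.integrable w).const_mul b)
  · exact (hd.const_mul _).const_mul _

theorem IsDissipationPotential.continuous {D : Dev → ℝ} (hD : IsDissipationPotential D) {CD : ℝ}
    (hCD : 0 ≤ CD) (hle : ∀ a : Dev, D a ≤ CD * ‖a‖) : Continuous D := by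
  refine (LipschitzWith.of_le_add_mul (K := CD.toNNReal) fun a b => ?_).continuous
  rw [Real.coe_toNNReal CD hCD, dist_eq_norm]
  have h := hD.triangle b (a - b)
  rw [add_sub_cancel] at h
  linarith [hle (a - b)]

theorem IsDissipationPotential.integrable {D : Dev → ℝ} (hD : IsDissipationPotential D) {CD : ℝ}
    (hCD : 0 ≤ CD) (hle : ∀ a : Dev, D a ≤ CD * ‖a‖) {Ω : Set E3}
    [IsFiniteMeasure (volume.restrict Ω)] (z w : L2 Ω Dev) :
    Integrable (fun x => D (z x - w x)) (volume.restrict Ω) := by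
  have hz := ((Lp.memLp z).integrable (by norm_num)).sub ((Lp.memLp w).integrable (by norm_num))
  refine (hz.norm.const_mul CD).mono'
    ((hD.continuous hCD hle).comp_aestronglyMeasurable hz.aestronglyMeasurable) ?_
  refine .of_forall fun x => ?_
  rw [Real.norm_of_nonneg (hD.nonneg _)]
  exact hle _

theorem IsDissipationPotential.dissipation_convex {D : Dev → ℝ} (hD : IsDissipationPotential D)
    {CD : ℝ} (hCD : 0 ≤ CD) (hle : ∀ a : Dev, D a ≤ CD * ‖a‖) {Ω : Set E3}
    [IsFiniteMeasure (volume.restrict Ω)] (z w zbar : L2 Ω Dev) {a b : ℝ} (ha : 0 < a)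
    (hb : 0 < b) (hab : a + b = 1) :
    dissipation Ω D (fun x => (a • z + b • w) x - zbar x) ≤
      a * dissipation Ω D (fun x => z x - zbar x)
        + b * dissipation Ω D (fun x => w x - zbar x) := by
  have iz := (hD.integrable hCD hle z zbar).const_mul a
  have iw := (hD.integrable hCD hle w zbar).const_mul b
  rw [dissipation, dissipation, dissipation, ← integral_const_mul, ← integral_const_mul,
    ← integral_add iz iw]
  refine integral_mono_ae (hD.integrable hCD hle _ _) (iz.add iw) ?_
  filter_upwards [Lp.coeFn_add (a • z) (b • w), Lp.coeFn_smul a z, Lp.coeFn_smul b w]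
    with x h1 h2 h3
  simp only [h1, h2, h3, Pi.add_apply, Pi.smul_apply]
  rw [← hD.homogeneous a ha, ← hD.homogeneous b hb]
  have e : a • z x + b • w x - zbar x = a • (z x - zbar x) + b • (w x - zbar x) := by
    obtain rfl : a = 1 - b := by linarith
    module
  rw [e]
  exact hD.triangle _ _

theorem IsDissipationPotential.dissipation_le {D : Dev → ℝ} (hD : IsDissipationPotential D)
    {CD : ℝ} (hCD : 0 ≤ CD) (hle : ∀ a : Dev, D a ≤ CD * ‖a‖) {Ω : Set E3}
    [IsFiniteMeasure (volume.restrict Ω)] (z v w : L2 Ω Dev) :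
    dissipation Ω D (fun x => z x - v x) ≤
      dissipation Ω D (fun x => z x - w x) + CD * ∫ x in Ω, ‖v x - w x‖ := by
  have hn : Integrable (fun x => CD * ‖v x - w x‖) (volume.restrict Ω) :=
    (((Lp.memLp v).integrable (by norm_num)).sub
      ((Lp.memLp w).integrable (by norm_num))).norm.const_mul CD
  have iw := hD.integrable hCD hle z w
  rw [dissipation, dissipation, ← integral_const_mul, ← integral_add iw hn]
  refine integral_mono (hD.integrable hCD hle z v) (iw.add hn) fun x => ?_
  have h := hD.triangle (z x - w x) (w x - v x)
  rw [sub_add_sub_cancel] at h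
  have h2 := hle (w x - v x)
  rw [norm_sub_rev] at h2
  exact h.trans (add_le_add_right h2 _)

end ShapeMemory

namespace ShapeMemory

/-! ### Linearity of traces -/

theorem continuous_classicalGrad {φ : E3 → E3} (hφ : ContDiff ℝ ∞ φ) :
    Continuous (classicalGrad φ) :=
  (PiLp.continuous_toLp 2 (fun _ : Fin 3 => E3)).comp
    (continuous_pi fun _ => (hφ.continuous_fderiv (by simp)).clm_apply continuous_const)

theorem classicalGrad_add_smul {φ ψ : E3 → E3} (hφ : ContDiff ℝ ∞ φ) (hψ : ContDiff ℝ ∞ ψ)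
    (a b : ℝ) (x : E3) :
    classicalGrad (a • φ + b • ψ) x = a • classicalGrad φ x + b • classicalGrad ψ x := by
  have h1 := hφ.differentiable (by simp) x
  have h2 := hψ.differentiable (by simp) x
  refine (congrArg Grad.mk (funext fun k => ?_) :)
  rw [fderiv_add (h1.const_smul a) (h2.const_smul b), fderiv_const_smul h1, fderiv_const_smul h2]
  rfl

theorem tendsto_eLpNorm_add_smul {X V : Type*} [MeasurableSpace X] [NormedAddCommGroup V]
    [NormedSpace ℝ V] {μ : Measure X} {f g : ℕ → X → V}
    (hf : ∀ n, AEStronglyMeasurable (f n) μ) (hg : ∀ n, AEStronglyMeasurable (g n) μ) (a b : ℝ)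
    (hf0 : Tendsto (fun n => eLpNorm (f n) 2 μ) atTop (𝓝 0))
    (hg0 : Tendsto (fun n => eLpNorm (g n) 2 μ) atTop (𝓝 0)) :
    Tendsto (fun n => eLpNorm (a • f n + b • g n) 2 μ) atTop (𝓝 0) := by
  have h1 := ENNReal.Tendsto.const_mul (a := ‖a‖ₑ) hf0 (Or.inr enorm_ne_top)
  have h2 := ENNReal.Tendsto.const_mul (a := ‖b‖ₑ) hg0 (Or.inr enorm_ne_top)
  have h3 := h1.add h2
  simp only [mul_zero, add_zero] at h3
  refine tendsto_of_tendsto_of_tendsto_of_le_of_le tendsto_const_nhds h3 (fun _ => zero_le)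
    fun n => ?_
  refine (eLpNorm_add_le ((hf n).const_smul a) ((hg n).const_smul b) (by norm_num)).trans ?_
  rw [eLpNorm_const_smul, eLpNorm_const_smul]

theorem HasTrace.add_smul {Ω : Set E3} {u v : USpace Ω} {g h : Lp E3 2 (surfaceMeasure Ω)}
    (hu : HasTrace u g) (hv : HasTrace v h) (a b : ℝ) :
    HasTrace (a • u + b • v) (a • g + b • h) := by
  obtain ⟨φ, hφ, u1, u2, u3⟩ := hu
  obtain ⟨ψ, hψ, v1, v2, v3⟩ := hv
  refine ⟨fun n => a • φ n + b • ψ n, fun n => ((hφ n).const_smul a).add ((hψ n).const_smul b),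
    ?_, ?_, ?_⟩
  · refine (tendsto_eLpNorm_add_smul (fun n => ?_) (fun n => ?_) a b u1 v1).congr fun n => ?_
    · exact (hφ n).continuous.aestronglyMeasurable.sub (Lp.aestronglyMeasurable _)
    · exact (hψ n).continuous.aestronglyMeasurable.sub (Lp.aestronglyMeasurable _)
    · refine eLpNorm_congr_ae ?_
      filter_upwards [Lp.coeFn_add (a • u.1.fst) (b • v.1.fst), Lp.coeFn_smul a u.1.fst,
        Lp.coeFn_smul b v.1.fst] with x h1 h2 h3
      have e : ((a • u + b • v : USpace Ω) : WithLp 2 (L2 Ω E3 × L2 Ω (Grad E3))).fst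
        = a • u.1.fst + b • v.1.fst := rfl
      rw [e, h1]
      simp only [Pi.add_apply, h2, h3, Pi.smul_apply]
      module
  · refine (tendsto_eLpNorm_add_smul (fun n => ?_) (fun n => ?_) a b u2 v2).congr fun n => ?_
    · exact (continuous_classicalGrad (hφ n)).aestronglyMeasurable.sub (Lp.aestronglyMeasurable _)
    · exact (continuous_classicalGrad (hψ n)).aestronglyMeasurable.sub (Lp.aestronglyMeasurable _)
    · refine eLpNorm_congr_ae ?_
      filter_upwards [Lp.coeFn_add (a • u.1.snd) (b • v.1.snd), Lp.coeFn_smul a u.1.snd,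
        Lp.coeFn_smul b v.1.snd] with x h1 h2 h3
      have e : ((a • u + b • v : USpace Ω) : WithLp 2 (L2 Ω E3 × L2 Ω (Grad E3))).snd
        = a • u.1.snd + b • v.1.snd := rfl
      rw [e, h1, classicalGrad_add_smul (hφ n) (hψ n)]
      simp only [Pi.add_apply, h2, h3, Pi.smul_apply]
      module
  · refine (tendsto_eLpNorm_add_smul (fun n => ?_) (fun n => ?_) a b u3 v3).congr fun n => ?_
    · exact (hφ n).continuous.aestronglyMeasurable.sub (Lp.aestronglyMeasurable _)
    · exact (hψ n).continuous.aestronglyMeasurable.sub (Lp.aestronglyMeasurable _)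
    · refine eLpNorm_congr_ae ?_
      filter_upwards [Lp.coeFn_add (a • g) (b • h), Lp.coeFn_smul a g,
        Lp.coeFn_smul b h] with x h1 h2 h3
      rw [h1]
      simp only [Pi.add_apply, h2, h3, Pi.smul_apply]
      module

theorem hasTrace_zero {Ω : Set E3} : HasTrace (0 : USpace Ω) 0 := by
  refine ⟨fun _ _ => 0, fun _ => contDiff_const, ?_, ?_, ?_⟩
  · refine tendsto_const_nhds.congr fun n => ?_
    refine (eLpNorm_zero (p := 2) (μ := volume.restrict Ω)).symm.trans (eLpNorm_congr_ae ?_)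
    filter_upwards [Lp.coeFn_zero E3 2 (volume.restrict Ω)] with x hx
    have e : ((0 : USpace Ω) : WithLp 2 (L2 Ω E3 × L2 Ω (Grad E3))).fst = 0 := rfl
    rw [e, hx]
    simp
  · refine tendsto_const_nhds.congr fun n => ?_
    refine (eLpNorm_zero (p := 2) (μ := volume.restrict Ω)).symm.trans (eLpNorm_congr_ae ?_)
    filter_upwards [Lp.coeFn_zero (Grad E3) 2 (volume.restrict Ω)] with x hx
    have e : ((0 : USpace Ω) : WithLp 2 (L2 Ω E3 × L2 Ω (Grad E3))).snd = 0 := rfl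
    have e' : classicalGrad (fun _ => 0) x = 0 := by
      refine (congrArg Grad.mk (funext fun k => ?_) :)
      simp
    rw [e, hx, e']
    simp
  · refine tendsto_const_nhds.congr fun n => ?_
    refine (eLpNorm_zero (p := 2) (μ := surfaceMeasure Ω)).symm.trans (eLpNorm_congr_ae ?_)
    filter_upwards [Lp.coeFn_zero E3 2 (surfaceMeasure Ω)] with x hx
    rw [hx]
    simp

theorem eqOnBoundary_refl {Ω : Set E3} (Γ : Set E3) (u : USpace Ω) : EqOnBoundary Γ u u := by
  refine ⟨0, by rw [sub_self]; exact hasTrace_zero, ?_⟩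
  exact ae_restrict_of_ae (Lp.coeFn_zero E3 2 (surfaceMeasure Ω))

theorem EqOnBoundary.add_smul {Ω Γ : Set E3} {u v u' v' : USpace Ω} (hu : EqOnBoundary Γ u u')
    (hv : EqOnBoundary Γ v v') (a b : ℝ) :
    EqOnBoundary Γ (a • u + b • v) (a • u' + b • v') := by
  obtain ⟨g, hg, hg0⟩ := hu
  obtain ⟨h, hh, hh0⟩ := hv
  refine ⟨a • g + b • h, ?_, ?_⟩
  · convert hg.add_smul hh a b using 1
    module
  · filter_upwards [hg0, hh0, ae_restrict_of_ae (Lp.coeFn_add (a • g) (b • h)),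
      ae_restrict_of_ae (Lp.coeFn_smul a g), ae_restrict_of_ae (Lp.coeFn_smul b h)]
      with x h1 h2 h3 h4 h5
    rw [h3, Pi.add_apply, h4, h5, Pi.smul_apply, Pi.smul_apply, h1, h2]
    simp

/-- For functions with equal traces on `Γ`, the Korn inequality has no boundary term. -/
theorem KornInequality.of_eqOnBoundary {Ω Γ : Set E3} {c₀ : ℝ} (hK : KornInequality Ω Γ c₀)
    {u v : USpace Ω} (h : EqOnBoundary Γ u v) :
    c₀ * ‖u - v‖ ^ 2 ≤ ∫ x in Ω, ‖strain (u - v) x‖ ^ 2 := by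
  obtain ⟨g, hg, hg0⟩ := h
  have h1 := hK _ g hg
  rwa [integral_eq_zero_of_ae, zero_add] at h1
  filter_upwards [hg0] with x hx
  simp [hx]

end ShapeMemory

/-! ### Convexity along segments -/

/-- The parallelogram identity along a segment, for a symmetric operator. -/
theorem LinearMap.IsSymmetric.inner_segment {H : Type*} [NormedAddCommGroup H]
    [InnerProductSpace ℝ H] {T : H →ₗ[ℝ] H} (hT : T.IsSymmetric) (x y : H) {a b : ℝ}
    (hab : a + b = 1) :
    inner ℝ (T (a • x + b • y)) (a • x + b • y) =
      a * inner ℝ (T x) x + b * inner ℝ (T y) y - a * b * inner ℝ (T (x - y)) (x - y) := by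
  have hs : inner ℝ (T y) x = inner ℝ (T x) y := by
    rw [hT y x, real_inner_comm]
  obtain rfl : a = 1 - b := by linarith
  simp only [map_add, map_sub, map_smul, inner_add_left, inner_add_right, inner_sub_left,
    inner_sub_right, real_inner_smul_left, real_inner_smul_right, hs]
  ring

theorem norm_sq_segment {H : Type*} [NormedAddCommGroup H] [InnerProductSpace ℝ H] (x y : H)
    {a b : ℝ} (hab : a + b = 1) :
    ‖a • x + b • y‖ ^ 2 = a * ‖x‖ ^ 2 + b * ‖y‖ ^ 2 - a * b * ‖x - y‖ ^ 2 := by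
  have h := (LinearMap.IsSymmetric.id (𝕜 := ℝ) (E := H)).inner_segment x y hab
  simpa only [LinearMap.id_apply, real_inner_self_eq_norm_sq] using h

theorem add_le_of_forall_segment {m M Q : ℝ}
    (h : ∀ t : ℝ, 0 < t → t < 1 → m ≤ (1 - t) * m + t * M - (1 - t) * t * Q) : m + Q ≤ M := by
  have ht : Tendsto (fun t : ℝ => m + (1 - t) * Q) (𝓝[>] 0) (𝓝 (m + (1 - 0) * Q)) :=
    (Continuous.tendsto (by fun_prop) 0).mono_left nhdsWithin_le_nhds
  rw [sub_zero, one_mul] at ht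
  refine le_of_tendsto ht ?_
  filter_upwards [Ioo_mem_nhdsGT (zero_lt_one' ℝ)] with t ht
  refine le_of_mul_le_mul_left ?_ ht.1
  linarith [h t ht.1 ht.2]

noncomputable section

namespace ShapeMemory

/-! ### The elastic energy as a quadratic form on `L²` -/

/-- The linearized strain as a linear map into `L²(Ω)`. -/
def strainL2 (Ω : Set E3) : USpace Ω →ₗ[ℝ] L2 Ω Sym :=
  ((LinearMap.toContinuousLinearMap symGrad).compLpL 2 (volume.restrict Ω)).toLinearMap ∘ₗ
    WithLp.sndₗ 2 ℝ (L2 Ω E3) (L2 Ω (Grad E3)) ∘ₗ (H1 Ω E3).subtype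

/-- The elastic strain `ε(u) - z` as a linear map into `L²(Ω)`. -/
def elasticStrain (Ω : Set E3) (ν : ℝ) : USpace Ω × ZSpace Ω ν →ₗ[ℝ] L2 Ω Sym :=
  strainL2 Ω ∘ₗ LinearMap.fst ℝ _ _ -
    ((LinearMap.toContinuousLinearMap devToSym).compLpL 2 (volume.restrict Ω)).toLinearMap ∘ₗ
      WithLp.fstₗ 2 ℝ (L2 Ω Dev) (L2 Ω (Grad Dev)) ∘ₗ (HSpace Ω Dev ν).subtype ∘ₗ
        LinearMap.snd ℝ _ _

/-- The pointwise action of an elasticity tensor on `L²(Ω)`. -/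
def elasticOp (Ω : Set E3) (C : Sym →ₗ[ℝ] Sym) : L2 Ω Sym →L[ℝ] L2 Ω Sym :=
  (LinearMap.toContinuousLinearMap C).compLpL 2 (volume.restrict Ω)

theorem coeFn_strainL2 {Ω : Set E3} (u : USpace Ω) :
    strainL2 Ω u =ᵐ[volume.restrict Ω] strain u :=
  ContinuousLinearMap.coeFn_compLpL (LinearMap.toContinuousLinearMap symGrad) u.1.snd

theorem norm_strainL2_sq {Ω : Set E3} (u : USpace Ω) :
    ‖strainL2 Ω u‖ ^ 2 = ∫ x in Ω, ‖strain u x‖ ^ 2 := by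
  rw [L2_norm_sq]
  refine integral_congr_ae ?_
  filter_upwards [coeFn_strainL2 u] with x hx
  rw [hx]

theorem norm_strainL2_le {Ω : Set E3} (u : USpace Ω) :
    ‖strainL2 Ω u‖ ≤ ‖LinearMap.toContinuousLinearMap symGrad‖ * ‖u‖ := by
  refine (ContinuousLinearMap.norm_compLp_le _ u.1.snd).trans ?_
  gcongr
  exact WithLp.norm_snd_le _ u.1

theorem coeFn_elasticStrain {Ω : Set E3} {ν : ℝ} (p : USpace Ω × ZSpace Ω ν) :
    elasticStrain Ω ν p =ᵐ[volume.restrict Ω]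
      fun x => strain p.1 x - devToSym (p.2.1.fst x) := by
  have h1 := Lp.coeFn_sub (strainL2 Ω p.1)
    ((LinearMap.toContinuousLinearMap devToSym).compLpL 2 (volume.restrict Ω) p.2.1.fst)
  have h2 := ContinuousLinearMap.coeFn_compLpL (p := 2) (μ := volume.restrict Ω)
    (LinearMap.toContinuousLinearMap devToSym) p.2.1.fst
  filter_upwards [h1, h2, coeFn_strainL2 p.1] with x h1 h2 h3
  refine h1.trans ?_
  rw [Pi.sub_apply, h2, h3]
  rfl

theorem norm_elasticStrain_le {Ω : Set E3} {ν : ℝ} (p : USpace Ω × ZSpace Ω ν) :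
    ‖elasticStrain Ω ν p‖ ≤ ‖strainL2 Ω p.1‖ + ‖p.2.1.fst‖ := by
  refine (norm_sub_le _ _).trans (add_le_add_right ?_ _)
  refine (ContinuousLinearMap.norm_compLp_le _ p.2.1.fst).trans ?_
  have h : ‖LinearMap.toContinuousLinearMap devToSym‖ ≤ 1 :=
    ContinuousLinearMap.opNorm_le_bound _ zero_le_one fun a => (one_mul ‖a‖).ge
  exact mul_le_of_le_one_left (norm_nonneg _) h

theorem coeFn_elasticOp {Ω : Set E3} (C : Sym →ₗ[ℝ] Sym) (a : L2 Ω Sym) :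
    elasticOp Ω C a =ᵐ[volume.restrict Ω] fun x => C (a x) :=
  ContinuousLinearMap.coeFn_compLpL (LinearMap.toContinuousLinearMap C) a

theorem norm_elasticOp_le (Ω : Set E3) (C : Sym →ₗ[ℝ] Sym) :
    ‖elasticOp Ω C‖ ≤ ‖LinearMap.toContinuousLinearMap C‖ :=
  ContinuousLinearMap.norm_compLpL_le _

theorem isSymmetric_elasticOp (Ω : Set E3) {C : Sym →ₗ[ℝ] Sym} (hC : IsElasticityTensor C) :
    (elasticOp Ω C).toLinearMap.IsSymmetric := fun a b => by
  rw [ContinuousLinearMap.coe_coe, L2.inner_def, L2.inner_def]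
  refine integral_congr_ae ?_
  filter_upwards [coeFn_elasticOp C a, coeFn_elasticOp C b] with x h1 h2
  rw [h1, h2]
  exact hC.1 _ _

theorem elasticEnergy_eq {Ω : Set E3} (C : Sym →ₗ[ℝ] Sym) {a : E3 → Sym} {b : L2 Ω Sym}
    (h : b =ᵐ[volume.restrict Ω] a) :
    elasticEnergy Ω C a = 1 / 2 * inner ℝ (elasticOp Ω C b) b := by
  rw [elasticEnergy, L2.inner_def]
  congr 1
  refine integral_congr_ae ?_
  filter_upwards [h, coeFn_elasticOp C b] with x h1 h2
  rw [h2, h1]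

theorem inner_elasticOp_nonneg (Ω : Set E3) {C : Sym →ₗ[ℝ] Sym} (hC : IsElasticityTensor C)
    (a : L2 Ω Sym) : 0 ≤ inner ℝ (elasticOp Ω C a) a := by
  rw [L2.inner_def]
  refine integral_nonneg_of_ae ?_
  filter_upwards [coeFn_elasticOp C a] with x h1
  rw [h1]
  by_cases h0 : a x = 0
  · simp [h0]
  · exact (hC.2 _ h0).le

/-! ### Strong minimality -/

/-- The quadratic form `½ ∫ ℂ(ε(u) - z) : (ε(u) - z) + (κ / 2) ∫ |z|² + (ν / 2) ∫ |∇z|²`, which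
measures the strong convexity of the incremental functional. -/
def convexityForm (Ω : Set E3) (C : Sym →ₗ[ℝ] Sym) (κ ν : ℝ) (p : USpace Ω × ZSpace Ω ν) : ℝ :=
  1 / 2 * inner ℝ (elasticOp Ω C (elasticStrain Ω ν p)) (elasticStrain Ω ν p)
    + κ / 2 * ‖p.2.1.fst‖ ^ 2 + ν / 2 * ‖p.2.1.snd‖ ^ 2

/-- Half of the ellipticity constant serves for `convexityForm`, which contains `(κ / 2) ∫ |z|²`
instead of `κ ∫ |z|²`. -/
theorem IsEllipticityConstant.le_convexityForm {Ω : Set E3} {C : Sym →ₗ[ℝ] Sym} {κ ν α : ℝ}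
    (h : IsEllipticityConstant Ω C κ ν α) (hC : IsElasticityTensor C) (hν : 0 ≤ ν)
    (p : USpace Ω × ZSpace Ω ν) :
    α * (‖strainL2 Ω p.1‖ ^ 2 + ‖p.2.1.fst‖ ^ 2 + ν * ‖p.2‖ ^ 2) ≤
      2 * convexityForm Ω C κ ν p := by
  have h1 := h.2 p.1 p.2
  rw [quadForm, elasticEnergy_eq C (coeFn_elasticStrain p), ← L2_norm_sq, ← L2_norm_sq,
    ← norm_strainL2_sq] at h1
  rw [convexityForm]
  have h2 := inner_elasticOp_nonneg Ω hC (elasticStrain Ω ν p)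
  have h3 : 0 ≤ ν * ‖p.2.1.snd‖ ^ 2 := by positivity
  linarith

/-- The values of the incremental functional where it is finite. -/
def realFunctional {Ω : Set E3} {ν : ℝ} (C : Sym →ₗ[ℝ] Sym) (f : Dev → ℝ)
    (D : Dev → ℝ) (ℓ : StrongDual ℝ (USpace Ω)) (zbar : L2 Ω Dev)
    (p : USpace Ω × ZSpace Ω ν) : ℝ :=
  1 / 2 * inner ℝ (elasticOp Ω C (elasticStrain Ω ν p)) (elasticStrain Ω ν p)
    + ((∫ x in Ω, f (p.2.1.fst x)) + ν / 2 * ‖p.2.1.snd‖ ^ 2) - ℓ p.1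
    + dissipation Ω D (fun x => p.2.1.fst x - zbar x)

section

variable {Ω Γ : Set E3} [IsFiniteMeasure (volume.restrict Ω)] {ν κ : ℝ} {C : Sym →ₗ[ℝ] Sym}
  {Φ : Dev → EReal} {f : Dev → ℝ} {S : Set Dev} {D : Dev → ℝ} {ℓ : StrongDual ℝ (USpace Ω)}
  {zbar : L2 Ω Dev} {uDir : USpace Ω} {p q : USpace Ω × ZSpace Ω ν}

theorem IsConvexDensity.incrementalFunctional_eq (h : IsConvexDensity κ Φ f S)
    (hp : ∀ᵐ x ∂(volume.restrict Ω), p.2.1.fst x ∈ S) :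
    incrementalFunctional C Φ D ℓ zbar p = (realFunctional C f D ℓ zbar p : EReal) := by
  rw [incrementalFunctional, storedEnergy, inelasticEnergy, h.integralFunctional_eq _ hp,
    elasticEnergy_eq C (coeFn_elasticStrain p), ← L2_norm_sq, realFunctional]
  norm_cast

/-- A solution has finite energy, because `(uDir, 0)` is admissible and has finite energy. -/
theorem SolvesIncremental.ae_mem (hp : SolvesIncremental Γ C Φ D uDir zbar ℓ p)
    (h : IsConvexDensity κ Φ f S) : ∀ᵐ x ∂(volume.restrict Ω), p.2.1.fst x ∈ S := by
  refine h.ae_mem _ fun htop => ?_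
  have h0 : ∀ᵐ x ∂(volume.restrict Ω),
      ((uDir, 0) : USpace Ω × ZSpace Ω ν).2.1.fst x ∈ S := by
    filter_upwards [Lp.coeFn_zero Dev 2 (volume.restrict Ω)] with x hx
    have e : (((0 : ZSpace Ω ν)) : WithLp 2 (L2 Ω Dev × L2 Ω (Grad Dev))).fst = 0 := rfl
    rw [e, hx]
    exact h.zero_mem
  have h1 : incrementalFunctional C Φ D ℓ zbar p ≤
      incrementalFunctional C Φ D ℓ zbar (uDir, 0) := hp.2 (eqOnBoundary_refl Γ uDir)
  rw [h.incrementalFunctional_eq h0, incrementalFunctional, storedEnergy, inelasticEnergy, htop,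
    EReal.top_add_coe, EReal.coe_add_top, EReal.top_sub_coe, EReal.top_add_coe] at h1
  exact EReal.coe_ne_top _ (top_le_iff.1 h1)

theorem IsConvexDensity.realFunctional_segment_le (h : IsConvexDensity κ Φ f S)
    (hC : IsElasticityTensor C) (hD : IsDissipationPotential D) {CD : ℝ} (hCD : 0 ≤ CD)
    (hle : ∀ a : Dev, D a ≤ CD * ‖a‖) {a b : ℝ} (ha : 0 < a) (hb : 0 < b) (hab : a + b = 1) :
    realFunctional C f D ℓ zbar (a • p + b • q) ≤
      a * realFunctional C f D ℓ zbar p + b * realFunctional C f D ℓ zbar q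
        - a * b * convexityForm Ω C κ ν (p - q) := by
  have e1 := (isSymmetric_elasticOp Ω hC).inner_segment (elasticStrain Ω ν p)
    (elasticStrain Ω ν q) hab
  rw [← map_smul, ← map_smul, ← map_add, ← map_sub] at e1
  simp only [ContinuousLinearMap.coe_coe] at e1
  have e2 := h.integral_le p.2.1.fst q.2.1.fst ha.le hb.le hab
  have e3 := norm_sq_segment p.2.1.snd q.2.1.snd hab
  have e4 := hD.dissipation_convex hCD hle p.2.1.fst q.2.1.fst zbar ha hb hab
  have e5 : ℓ (a • p + b • q).1 = a * ℓ p.1 + b * ℓ q.1 := by simp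
  have d1 : (a • p + b • q).2.1.fst = a • p.2.1.fst + b • q.2.1.fst := rfl
  have d2 : (a • p + b • q).2.1.snd = a • p.2.1.snd + b • q.2.1.snd := rfl
  have d3 : (p - q).2.1.fst = p.2.1.fst - q.2.1.fst := rfl
  have d4 : (p - q).2.1.snd = p.2.1.snd - q.2.1.snd := rfl
  simp only [realFunctional, convexityForm, e1, e5, d1, d2, d3, d4, e3]
  linarith

/-- Minimality against the points of the segment from `p` to `q`, near `p`, gains the strong
convexity of the functional. -/
theorem SolvesIncremental.realFunctional_add_le (hp : SolvesIncremental Γ C Φ D uDir zbar ℓ p)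
    (h : IsConvexDensity κ Φ f S) (hC : IsElasticityTensor C) (hD : IsDissipationPotential D)
    {CD : ℝ} (hCD : 0 ≤ CD) (hle : ∀ a : Dev, D a ≤ CD * ‖a‖)
    (hq : EqOnBoundary Γ q.1 uDir) (hqS : ∀ᵐ x ∂(volume.restrict Ω), q.2.1.fst x ∈ S) :
    realFunctional C f D ℓ zbar p + convexityForm Ω C κ ν (p - q) ≤
      realFunctional C f D ℓ zbar q := by
  refine add_le_of_forall_segment fun t ht ht1 => ?_
  have hs := h.realFunctional_segment_le (p := p) (q := q) (ℓ := ℓ) (zbar := zbar) hC hD hCD hle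
    (sub_pos.2 ht1) ht (sub_add_cancel 1 t)
  refine le_trans ?_ hs
  have hadm : (1 - t) • p + t • q ∈ admissible Ω Γ ν uDir := by
    have := EqOnBoundary.add_smul hp.1 hq (1 - t) t
    rwa [← _root_.add_smul, sub_add_cancel, one_smul] at this
  have hmem : ∀ᵐ x ∂(volume.restrict Ω), ((1 - t) • p + t • q).2.1.fst x ∈ S := by
    filter_upwards [hp.ae_mem h, hqS, Lp.coeFn_add ((1 - t) • p.2.1.fst) (t • q.2.1.fst),
      Lp.coeFn_smul (1 - t) p.2.1.fst, Lp.coeFn_smul t q.2.1.fst] with x h1 h2 h3 h4 h5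
    have d1 : ((1 - t) • p + t • q).2.1.fst = (1 - t) • p.2.1.fst + t • q.2.1.fst := rfl
    rw [d1, h3, Pi.add_apply, h4, h5]
    exact h.convex h1 h2 (sub_pos.2 ht1).le ht.le (sub_add_cancel 1 t)
  have hmin : incrementalFunctional C Φ D ℓ zbar p ≤
      incrementalFunctional C Φ D ℓ zbar ((1 - t) • p + t • q) := hp.2 hadm
  rw [h.incrementalFunctional_eq (hp.ae_mem h), h.incrementalFunctional_eq hmem] at hmin
  exact EReal.coe_le_coe_iff.1 hmin

/-! ### Comparison of two solutions -/

/-- The first solution is tested with `(u₂ + e, z₂)` and the second one with `(u₁ - e, z₁)`, where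
`e` is the difference of the Dirichlet data. The inelastic energies cancel in the sum. -/
theorem SolvesIncremental.convexityForm_le {zbar₁ zbar₂ : L2 Ω Dev}
    {uDir₁ uDir₂ u₁ u₂ : USpace Ω} {ℓ₁ ℓ₂ : StrongDual ℝ (USpace Ω)} {z₁ z₂ : ZSpace Ω ν}
    (s₁ : SolvesIncremental Γ C Φ D uDir₁ zbar₁ ℓ₁ (u₁, z₁))
    (s₂ : SolvesIncremental Γ C Φ D uDir₂ zbar₂ ℓ₂ (u₂, z₂))
    (h : IsConvexDensity κ Φ f S) (hC : IsElasticityTensor C) (hD : IsDissipationPotential D)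
    {CD : ℝ} (hCD : 0 ≤ CD) (hle : ∀ a : Dev, D a ≤ CD * ‖a‖) :
    2 * convexityForm Ω C κ ν (u₁ - u₂ - (uDir₁ - uDir₂), z₁ - z₂) ≤
      (ℓ₁ - ℓ₂) (u₁ - u₂ - (uDir₁ - uDir₂))
        - inner ℝ (elasticOp Ω C (elasticStrain Ω ν (u₁ - u₂ - (uDir₁ - uDir₂), z₁ - z₂)))
          (strainL2 Ω (uDir₁ - uDir₂))
        + 2 * CD * ∫ x in Ω, ‖zbar₁ x - zbar₂ x‖ := by
  set e := uDir₁ - uDir₂ with he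
  have t₁ := s₁.realFunctional_add_le (q := (u₂ + e, z₂)) h hC hD hCD hle
    (by
      obtain ⟨g, hg, hg0⟩ := s₂.1
      refine ⟨g, ?_, hg0⟩
      convert hg using 1
      rw [he]
      module) (s₂.ae_mem h)
  have t₂ := s₂.realFunctional_add_le (q := (u₁ - e, z₁)) h hC hD hCD hle
    (by
      obtain ⟨g, hg, hg0⟩ := s₁.1
      refine ⟨g, ?_, hg0⟩
      convert hg using 1
      rw [he]
      module) (s₁.ae_mem h)
  have d₁ : ((u₁, z₁) - (u₂ + e, z₂) : USpace Ω × ZSpace Ω ν) = (u₁ - u₂ - e, z₁ - z₂) := by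
    ext1
    · simp only [Prod.fst_sub]
      abel
    · rfl
  have d₂ : ((u₂, z₂) - (u₁ - e, z₁) : USpace Ω × ZSpace Ω ν) = -(u₁ - u₂ - e, z₁ - z₂) := by
    ext1
    · simp only [Prod.fst_sub, Prod.fst_neg]
      abel
    · simp only [Prod.snd_sub, Prod.snd_neg]
      abel
  have hneg : ∀ r : USpace Ω × ZSpace Ω ν,
      convexityForm Ω C κ ν (-r) = convexityForm Ω C κ ν r := fun r => by
    have n1 : (-r).2.1.fst = -r.2.1.fst := rfl
    have n2 : (-r).2.1.snd = -r.2.1.snd := rfl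
    simp only [convexityForm, map_neg, inner_neg_neg, n1, n2, norm_neg]
  rw [d₁] at t₁
  rw [d₂, hneg] at t₂
  have σ : ∀ (u : USpace Ω) (z : ZSpace Ω ν),
      elasticStrain Ω ν (u + e, z) = elasticStrain Ω ν (u, z) + strainL2 Ω e := fun u z => by
    simp only [elasticStrain, LinearMap.sub_apply, LinearMap.comp_apply, LinearMap.fst_apply,
      LinearMap.snd_apply, map_add]
    abel
  have σ' : elasticStrain Ω ν (u₁ - e, z₁) = elasticStrain Ω ν (u₁, z₁) - strainL2 Ω e := by
    rw [eq_sub_iff_add_eq, ← σ, sub_add_cancel]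
  have σ₃ : elasticStrain Ω ν (u₁ - u₂ - e, z₁ - z₂) =
      elasticStrain Ω ν (u₁, z₁) - elasticStrain Ω ν (u₂, z₂) - strainL2 Ω e := by
    rw [← d₁, map_sub, σ, sub_add_eq_sub_sub]
  have hsymm : ∀ a b : L2 Ω Sym,
      inner ℝ (elasticOp Ω C a) b = inner ℝ (elasticOp Ω C b) a := fun a b => by
    have := isSymmetric_elasticOp Ω hC a b
    exact this.trans (real_inner_comm _ _)
  have D₁ := hD.dissipation_le hCD hle z₂.1.fst zbar₁ zbar₂
  have D₂ := hD.dissipation_le hCD hle z₁.1.fst zbar₂ zbar₁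
  simp only [norm_sub_rev (zbar₂ _)] at D₂
  simp only [realFunctional, σ, σ', map_add, map_sub, inner_add_left, inner_add_right,
    inner_sub_left, inner_sub_right, hsymm (strainL2 Ω e)] at t₁ t₂
  simp only [σ₃, map_sub, inner_sub_left, sub_apply]
  linarith

end

end ShapeMemory

end

namespace ShapeMemory

/-- The absorption argument: `X`, `Z` and `N` stand for `‖ε(u - e)‖`, `‖z‖` and `ν ‖z‖²`, where `u`
and `z` are the differences of the solutions and `e` is that of the Dirichlet data, and `W` for
`‖u - e‖`. -/
theorem absorption_estimate {α c₀ CD K s X Z N W E ℓ I : ℝ} (hα : 0 < α) (hc₀ : 0 < c₀)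
    (hCD : 0 < CD) (hN : 0 ≤ N) (hI : 0 ≤ I)
    (hKorn : c₀ * W ^ 2 ≤ X ^ 2)
    (h : α * (X ^ 2 + Z ^ 2 + N) ≤ ℓ * W + K * (X + Z) * (s * E) + 2 * CD * I) :
    2 * W ^ 2 + 2 * E ^ 2 + Z ^ 2 + N ≤
      ((2 / c₀ + 1) * (2 / α) * (1 / (α * c₀) + 2 * (K * s) ^ 2 / α + 2 * CD) + 2) *
        (E ^ 2 + I + ℓ ^ 2) := by
  -- Young's inequality for the three products on the right of `h`
  have y1 : ℓ * W ≤ α / 4 * X ^ 2 + ℓ ^ 2 / (α * c₀) := by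
    have : ℓ * W ≤ α * c₀ / 4 * W ^ 2 + ℓ ^ 2 / (α * c₀) := by
      have e : α * c₀ / 4 * W ^ 2 + ℓ ^ 2 / (α * c₀) - ℓ * W =
          (α * c₀ / 2 * W - ℓ) ^ 2 / (α * c₀) := by
        field_simp
        ring
      have : 0 ≤ (α * c₀ / 2 * W - ℓ) ^ 2 / (α * c₀) := by positivity
      linarith
    nlinarith
  have y : ∀ Y : ℝ, K * Y * (s * E) ≤ α / 4 * Y ^ 2 + (K * s) ^ 2 / α * E ^ 2 := fun Y => by
    have e : α / 4 * Y ^ 2 + (K * s) ^ 2 / α * E ^ 2 - K * Y * (s * E) =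
        (α / 2 * Y - K * s * E) ^ 2 / α := by
      field_simp
      ring
    have : 0 ≤ (α / 2 * Y - K * s * E) ^ 2 / α := by positivity
    linarith
  set A := 1 / (α * c₀) + 2 * (K * s) ^ 2 / α + 2 * CD with hA
  set T := E ^ 2 + I + ℓ ^ 2 with hT
  have hE : 0 ≤ E ^ 2 := sq_nonneg E
  have hℓ : 0 ≤ ℓ ^ 2 := sq_nonneg ℓ
  have hR : ℓ ^ 2 / (α * c₀) + 2 * ((K * s) ^ 2 / α * E ^ 2) + 2 * CD * I ≤ A * T := by
    have a1 : 0 ≤ 1 / (α * c₀) := by positivity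
    have a2 : 0 ≤ 2 * (K * s) ^ 2 / α := by positivity
    have r1 : ℓ ^ 2 / (α * c₀) = 1 / (α * c₀) * ℓ ^ 2 := by ring
    have r2 : 2 * ((K * s) ^ 2 / α * E ^ 2) = 2 * (K * s) ^ 2 / α * E ^ 2 := by ring
    rw [r1, r2, hA, add_mul, add_mul]
    gcongr <;> linarith
  have hS : X ^ 2 + Z ^ 2 + N ≤ 2 / α * (A * T) := by
    rw [div_mul_eq_mul_div, le_div_iff₀ hα]
    nlinarith [y X, y Z, mul_nonneg hα.le hN]
  have hW : 2 * W ^ 2 ≤ 2 / c₀ * X ^ 2 := by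
    rw [div_mul_eq_mul_div, le_div_iff₀ hc₀]
    linarith
  have hS' : (2 / c₀ + 1) * (X ^ 2 + Z ^ 2 + N) ≤ (2 / c₀ + 1) * (2 / α * (A * T)) := by
    gcongr
  have p : 0 ≤ 2 / c₀ * (Z ^ 2 + N) := by positivity
  have e : ((2 / c₀ + 1) * (2 / α) * A + 2) * T = (2 / c₀ + 1) * (2 / α * (A * T)) + 2 * T := by
    ring
  rw [e]
  nlinarith [sq_nonneg X]

end ShapeMemory

open ShapeMemory in
theorem lemma4p2
    (C : Sym →ₗ[ℝ] Sym) (hC : IsElasticityTensor C)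
    (c₀ α CD : ℝ) (hc₀ : 0 < c₀) (hα : 0 < α) (hCD : 0 < CD) :
    ∃ c : ℝ, 0 < c ∧
      ∀ (Ω ΓDir : Set E3), IsLipschitzDomain Ω →
        ΓDir ⊆ frontier Ω → (∃ U : Set E3, IsOpen U ∧ ΓDir = U ∩ frontier Ω) →
        KornInequality Ω ΓDir c₀ →
      ∀ (c₁ c₂ c₃ : ℝ), 0 < c₁ → 0 < c₂ → 0 < c₃ →
      ∀ (Freg : ℝ → Dev → ℝ), (∀ ρ > 0, IsRegularizedDensity c₂ (Freg ρ)) →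
      ∀ (D : Dev → ℝ), IsDissipationPotential D → (∀ a : Dev, D a ≤ CD * ‖a‖) →
      ∀ (ρ ν : ℝ), 0 ≤ ρ → 0 ≤ ν → IsEllipticityConstant Ω C c₂ ν α →
      ∀ (zbar₁ zbar₂ : L2 Ω Dev) (uDir₁ uDir₂ : USpace Ω)
        (ℓ₁ ℓ₂ : StrongDual ℝ (USpace Ω))
        (u₁ u₂ : USpace Ω) (z₁ z₂ : ZSpace Ω ν),
        SolvesIncremental ΓDir C (density c₁ c₂ c₃ Freg ρ) D uDir₁ zbar₁ ℓ₁ (u₁, z₁) →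
        SolvesIncremental ΓDir C (density c₁ c₂ c₃ Freg ρ) D uDir₂ zbar₂ ℓ₂ (u₂, z₂) →
        ‖u₁ - u₂‖ ^ 2 + ‖(z₁ - z₂).1.fst‖ ^ 2 + ν * ‖z₁ - z₂‖ ^ 2 ≤
          c * (‖uDir₁ - uDir₂‖ ^ 2 + (∫ x in Ω, ‖zbar₁ x - zbar₂ x‖) + ‖ℓ₁ - ℓ₂‖ ^ 2) := by
  set K := ‖LinearMap.toContinuousLinearMap C‖ with hK
  set s := ‖LinearMap.toContinuousLinearMap symGrad‖ with hs
  refine ⟨(2 / c₀ + 1) * (2 / α) * (1 / (α * c₀) + 2 * (K * s) ^ 2 / α + 2 * CD) + 2,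
    by positivity, ?_⟩
  intro Ω Γ hΩ _ _ hKorn c₁ c₂ c₃ h₁ h₂ h₃ Freg hF D hD hle ρ ν hρ hν hell zbar₁ zbar₂
    uDir₁ uDir₂ ℓ₁ ℓ₂ u₁ u₂ z₁ z₂ s₁ s₂
  have : IsFiniteMeasure (volume.restrict Ω) :=
    isFiniteMeasure_restrict.2 hΩ.isBounded.measure_lt_top.ne
  obtain ⟨f, S, h⟩ := exists_isConvexDensity h₁ h₂ h₃ hF hρ
  set e := uDir₁ - uDir₂ with he
  set w := u₁ - u₂ - e with hw
  have key := s₁.convexityForm_le s₂ h hC hD hCD.le hle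
  rw [← he, ← hw] at key
  have hcoer := hell.le_convexityForm hC hν (w, z₁ - z₂)
  have hk : c₀ * ‖w‖ ^ 2 ≤ ‖strainL2 Ω w‖ ^ 2 := by
    rw [norm_strainL2_sq]
    have hb := EqOnBoundary.add_smul s₁.1 s₂.1 1 (-1)
    have ew : (1 : ℝ) • u₁ + (-1 : ℝ) • u₂ - ((1 : ℝ) • uDir₁ + (-1 : ℝ) • uDir₂) = w := by
      rw [hw, he]
      module
    have := hKorn.of_eqOnBoundary hb
    rwa [ew] at this
  have hl : (ℓ₁ - ℓ₂) w ≤ ‖ℓ₁ - ℓ₂‖ * ‖w‖ :=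
    (le_abs_self _).trans ((ℓ₁ - ℓ₂).le_opNorm w)
  have hi : -inner ℝ (elasticOp Ω C (elasticStrain Ω ν (w, z₁ - z₂))) (strainL2 Ω e) ≤
      K * (‖strainL2 Ω w‖ + ‖(z₁ - z₂).1.fst‖) * (s * ‖e‖) := by
    refine (neg_le_abs _).trans ((abs_real_inner_le_norm _ _).trans ?_)
    gcongr
    · exact ((elasticOp Ω C).le_opNorm _).trans (mul_le_mul (norm_elasticOp_le Ω C)
        (norm_elasticStrain_le _) (norm_nonneg _) (norm_nonneg _))
    · exact norm_strainL2_le e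
  have hfin := absorption_estimate (K := K) (s := s) (W := ‖w‖) (E := ‖e‖) (ℓ := ‖ℓ₁ - ℓ₂‖)
    (X := ‖strainL2 Ω w‖) (Z := ‖(z₁ - z₂).1.fst‖)
    (N := ν * ‖z₁ - z₂‖ ^ 2) (I := ∫ x in Ω, ‖zbar₁ x - zbar₂ x‖) hα hc₀ hCD (by positivity)
    (integral_nonneg fun _ => norm_nonneg _) hk
    (hcoer.trans (key.trans (by linarith)))
  refine le_trans ?_ hfin
  have hu : ‖u₁ - u₂‖ ≤ ‖w‖ + ‖e‖ := by
    have := norm_add_le w e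
    rwa [hw, sub_add_cancel] at this
  have hu2 : ‖u₁ - u₂‖ ^ 2 ≤ (‖w‖ + ‖e‖) ^ 2 := by gcongr
  linarith [sq_nonneg (‖w‖ - ‖e‖), add_sq ‖w‖ ‖e‖, sub_sq ‖w‖ ‖e‖]
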